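/- Let $n\ge 3$ be odd and $U=\mathbf R^n\setminus\{0\}$, regarded as a subset of $\mathbf C^n$. Write $\langle z,w\rangle=\sum_i z_iw_i$ and $z^2=\langle z,z\rangle$ for $z,w\in\mathbf C^n$, and let $\|z\|$ be the Hermitian norm. A function $u$ on $U$ extends to an open set $W\subseteq\mathbf C^n$ if there is a holomorphic function on $W$ that equals $u$ on $U\cap W$. An extension domain is a connected open set $W\subseteq\mathbf C^n$ with $W\cap U\ne\emptyset$ to which all harmonic functions on $U$ extend. A harmonic hull of $U$ is an extension domain $H\supseteq U$ that contains every extension domain $W\supseteq U$. Let $\tilde U$ be the connected component containing $U$ of $\mathbf C^n\setminus\bigcup_{x\in\mathbf R^n\setminus U}\{w:\langle w-x,w-x\rangle=0\}$. For $V\subseteq\mathbf R^n$ open, the reduced harmonic hull of $V$ is the set of $z\in\mathbf C^n$ such that $\langle z-x,z-x\rangle\notin\mathbf R_{\le 0}$ for all $x\in\mathbf R^n\setminus V$. Then the following hold. 1. $\tilde U=\mathbf C^n\setminus\{z^2=0\}$. 2. ($\tilde U$ is the only candidate for the harmonic hull.) Every extension domain is contained in $\tilde U$, and $\tilde U$ is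 the union of all the extension domains that contain $U$. 3. The Newtonian potential $\|x\|^{2-n}$ is harmonic on $U$ but does not extend to $\tilde U$. 4. $U$ has no harmonic hull. 5. For $\varepsilon\in\mathbf R$ put $$W_\varepsilon=\Big\{z\in\mathbf C^n:\ 9\varepsilon^2\|z\|^2<1,\ \frac{z^2}{1+2\varepsilon z_1+\varepsilon^2z^2}\notin\mathbf R_{\le 0}\Big\}.$$ Then $W_0$ is the reduced harmonic hull of $U$ and, for $\varepsilon\ne0$, $W_\varepsilon$ is the set of $z$ with $9\varepsilon^2\|z\|^2<1$ whose image under the conformal transformation $z\mapsto\dfrac{z+\varepsilon z^2e_1}{1+2\varepsilon z_1+\varepsilon^2z^2}$ lies in the reduced harmonic hull of $\mathbf R^n\setminus\{0,\varepsilon^{-1}e_1\}$, where $e_1=(1,0,\dots,0)$. For all $A\in\mathrm{SO}(n)$ and $\varepsilon\in\mathbf R$ the set $A W_\varepsilon$ is an extension domain, and $$\tilde U=\bigcup_{A\in\mathrm{SO}(n)}\ \bigcup_{\varepsilon\in\mathbf R}A W_\varepsilon .$$ -/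

import Mathlib

open Set

noncomputable section

namespace HarmonicHull

/-- The real Euclidean space of dimension `n`. -/
abbrev RSpace (n : ℕ) : Type := EuclideanSpace ℝ (Fin n)

/-- Complex `n`-space, with its Hermitian norm. -/
abbrev CSpace (n : ℕ) : Type := EuclideanSpace ℂ (Fin n)

/-- The inclusion of real `n`-space as the real part of complex `n`-space. -/
def toC {n : ℕ} (x : RSpace n) : CSpace n :=
  WithLp.toLp 2 (fun i => (x i : ℂ))

/-- The complex bilinear (not Hermitian) form `⟨z, w⟩ = ∑ zᵢ wᵢ`. -/
def bform {n : ℕ} (z w : CSpace n) : ℂ := ∑ i, z i * w i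

/-- The isotropic cone `V(z)` through `z`. -/
def isotropicCone {n : ℕ} (z : CSpace n) : Set (CSpace n) :=
  {w | bform (w - z) (w - z) = 0}

/-- For connected `U`, the connected component containing `U` of the complement of the union of the
isotropic cones through the real points outside `U`. (All the components in the union below
coincide when `U` is connected.) -/
def tildeHull {n : ℕ} (U : Set (RSpace n)) : Set (CSpace n) :=
  ⋃ x ∈ U, connectedComponentIn (⋃ y ∈ Uᶜ, isotropicCone (toC y))ᶜ (toC x)

/-- The function `u` on the real set `U` extends holomorphically to the set `W` of complex
`n`-space. -/
def ExtendsTo {n : ℕ} (U : Set (RSpace n)) (u : RSpace n → ℂ) (W : Set (CSpace n)) : Prop :=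
  ∃ g : CSpace n → ℂ, DifferentiableOn ℂ g W ∧ ∀ x ∈ U, toC x ∈ W → g (toC x) = u x

/-- `W` is a connected open set of complex `n`-space, meeting `U`, to which all harmonic functions
on `U` extend. (The extension of each harmonic function is then unique.) -/
structure IsExtensionDomain {n : ℕ} (U : Set (RSpace n)) (W : Set (CSpace n)) : Prop where
  isOpen : IsOpen W
  isConnected : IsConnected W
  meets : ∃ x ∈ U, toC x ∈ W
  extends_harmonic : ∀ u : RSpace n → ℂ, InnerProductSpace.HarmonicOnNhd u U → ExtendsTo U u W

/-- `H` is the harmonic hull of `U`: the largest connected open set containing `U` to which all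
harmonic functions on `U` extend. -/
def IsHarmonicHull {n : ℕ} (U : Set (RSpace n)) (H : Set (CSpace n)) : Prop :=
  IsGreatest {W | IsExtensionDomain U W ∧ toC '' U ⊆ W} H

/-- The reduced harmonic hull of `U`: the points `z` such that `⟨z - x, z - x⟩` is not a real number
`≤ 0` for any real point `x` outside `U`. (`Complex.slitPlane` is the complement of the set of
real numbers `≤ 0`.) -/
def reducedHull {n : ℕ} (U : Set (RSpace n)) : Set (CSpace n) :=
  {z | ∀ x ∈ Uᶜ, bform (z - toC x) (z - toC x) ∈ Complex.slitPlane}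

/-- The first standard basis vector. -/
def e₁ (n : ℕ) [NeZero n] : RSpace n := EuclideanSpace.single 0 1

/-- The denominator `1 + 2 ε z₁ + ε² z²`. -/
def confDenom {n : ℕ} [NeZero n] (ε : ℝ) (z : CSpace n) : ℂ :=
  1 + 2 * (ε : ℂ) * z 0 + (ε : ℂ) ^ 2 * bform z z

/-- The conformal transformation `z ↦ (z + ε z² e₁) / (1 + 2 ε z₁ + ε² z²)`, which is the inversion
`z ↦ z / z²`, followed by the translation by `ε e₁`, followed by the inversion again. -/
def confMap {n : ℕ} [NeZero n] (ε : ℝ) (z : CSpace n) : CSpace n :=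
  (confDenom ε z)⁻¹ • (z + ((ε : ℂ) * bform z z) • toC (e₁ n))

/-- The set of all `z` with `‖z‖² < 1 / (9 ε²)` (no condition when `ε = 0`) for which
`z² / (1 + 2 ε z₁ + ε² z²)` is not a real number `≤ 0`. -/
def curvedHull (n : ℕ) [NeZero n] (ε : ℝ) : Set (CSpace n) :=
  {z | 9 * ε ^ 2 * ‖z‖ ^ 2 < 1 ∧ bform z z / confDenom ε z ∈ Complex.slitPlane}

/-- The complex linear action of a real matrix on complex `n`-space. -/
def matAct {n : ℕ} (A : Matrix (Fin n) (Fin n) ℝ) (z : CSpace n) : CSpace n :=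
  WithLp.toLp 2 ((A.map (fun t : ℝ => (t : ℂ))).mulVec z.ofLp)

/-- The Newtonian potential `‖x‖^(2 - n)` centred at the origin (for `n ≥ 3`). -/
def newtonian (n : ℕ) (x : RSpace n) : ℂ := (((‖x‖ ^ (n - 2))⁻¹ : ℝ) : ℂ)

end HarmonicHull

end

/-!
A harmonic function `u` on the punctured space has a Laurent decomposition
`u(x) = F(x) + ‖x‖ ^ (2 - n) G(x / ‖x‖²)` with entire functions `F` and `G` on complex `n`-space
(`exists_laurent_decomposition`). Hence `u` extends to every open set on which `z²` has a
holomorphic square root that is positive at the real points (`extendsTo_of_sqrt`), and the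
statements about extension domains become statements about square roots of `z²`.

The decomposition comes from the fundamental solution of the Laplacian. Cutting `u` off in a shell
`r < ‖x‖ < R` writes it as a difference of two Newtonian potentials, of densities supported in an
outer and an inner shell (`exists_integral_shellDensity_sub`). The outer potential extends
holomorphically to a complex ball about the origin of radius proportional to `R`, and the Kelvin
transform of the inner one to a ball of radius proportional to `1 / r`. Since the outer density does
not depend on `r`, nor the inner one on `R`, these functions fit together to entire functions.

On `curvedHull n ε` both the quotient of `z²` by the conformal denominator and the denominator
itself avoid the real numbers `≤ 0`, so that the product of their principal square roots is the
required root (`curvedSqrt`). For the connectedness (`isPreconnected_curvedHull`), a point is moved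
towards the origin along the path on which the conformal quotient is multiplied by positive reals; a
barrier argument keeps the path in the ball (`le_norm_scale`). Near the origin the set looks like
`curvedHull n 0`, where a point `x + i y` can be joined to `x` by the segment `x + i t y`. A point
off the null cone lies in `curvedHull n 0`, unless `z²` is negative; then some coordinate is not
real, a rotation turns it into the first one, and the denominator for a small `ε` is not real
(`setOf_bform_ne_zero_eq_iUnion`). A union of a rotated curved hull and a wedge around the punctured
real space is an extension domain that contains the punctured space.

In the other direction, if `g` extends the Newtonian potential to a connected open set, then
`g² (z²) ^ (n - 2) = 1` there, so that an extension domain avoids the null cone. On the complex line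
through `e₁` an extension to the whole complement of the null cone would have to be `t ^ (2 - n)`,
which for odd `n` is negative at `t = -1`. The identity theorem used throughout
(`eqOn_of_eventually_real`) only needs functions of one variable, because it can be applied on
complex lines.
-/

namespace HarmonicHull

open Filter Topology Complex

variable {n : ℕ}

/-! ### The bilinear form and the real and imaginary parts -/

/-- The real part of a complex vector. -/
noncomputable def reC (z : CSpace n) : RSpace n := WithLp.toLp 2 fun i => (z i).re

/-- The imaginary part of a complex vector. -/
noncomputable def imC (z : CSpace n) : RSpace n := WithLp.toLp 2 fun i => (z i).im

@[simp] lemma toC_apply (x : RSpace n) (i : Fin n) : toC x i = (x i : ℂ) := rfl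

@[simp] lemma reC_apply (z : CSpace n) (i : Fin n) : reC z i = (z i).re := rfl

@[simp] lemma imC_apply (z : CSpace n) (i : Fin n) : imC z i = (z i).im := rfl

lemma toC_add (x y : RSpace n) : toC (x + y) = toC x + toC y := by ext i; simp

lemma toC_smul (c : ℝ) (x : RSpace n) : toC (c • x) = (c : ℂ) • toC x := by ext i; simp

@[simp] lemma toC_zero : toC (0 : RSpace n) = 0 := by ext i; simp

lemma toC_re_add_im (z : CSpace n) : toC (reC z) + I • toC (imC z) = z := by
  ext i
  simp [mul_comm I, Complex.re_add_im]

@[simp] lemma reC_toC_add (x y : RSpace n) : reC (toC x + I • toC y) = x := by ext i; simp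

@[simp] lemma imC_toC_add (x y : RSpace n) : imC (toC x + I • toC y) = y := by ext i; simp

lemma norm_sq_re_add_im (z : CSpace n) : ‖z‖ ^ 2 = ‖reC z‖ ^ 2 + ‖imC z‖ ^ 2 := by
  simp only [EuclideanSpace.norm_sq_eq, ← Finset.sum_add_distrib, reC_apply, imC_apply,
    Real.norm_eq_abs, sq_abs]
  refine Finset.sum_congr rfl fun i _ => ?_
  rw [Complex.sq_norm, Complex.normSq_apply]
  ring

@[simp] lemma norm_toC (x : RSpace n) : ‖toC x‖ = ‖x‖ := by
  simp [EuclideanSpace.norm_eq]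

lemma continuous_toC : Continuous (toC (n := n)) := by
  unfold toC
  fun_prop

lemma continuous_reC : Continuous (reC (n := n)) := by
  unfold reC
  fun_prop

lemma continuous_imC : Continuous (imC (n := n)) := by
  unfold imC
  fun_prop

lemma bform_comm (z w : CSpace n) : bform z w = bform w z := by
  simp [bform, mul_comm]

lemma bform_add_left (z z' w : CSpace n) : bform (z + z') w = bform z w + bform z' w := by
  simp [bform, add_mul, Finset.sum_add_distrib]

lemma bform_smul_left (c : ℂ) (z w : CSpace n) : bform (c • z) w = c * bform z w := by
  simp [bform, Finset.mul_sum, mul_assoc]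

lemma bform_add_right (z w w' : CSpace n) : bform z (w + w') = bform z w + bform z w' := by
  simp [bform, mul_add, Finset.sum_add_distrib]

lemma bform_smul_right (c : ℂ) (z w : CSpace n) : bform z (c • w) = c * bform z w := by
  rw [bform_comm, bform_smul_left, bform_comm]

lemma bform_sub_left (z z' w : CSpace n) : bform (z - z') w = bform z w - bform z' w := by
  simp [bform, sub_mul, Finset.sum_sub_distrib]

lemma bform_sub_right (z w w' : CSpace n) : bform z (w - w') = bform z w - bform z w' := by
  simp [bform, mul_sub, Finset.sum_sub_distrib]

lemma bform_smul_self (c : ℂ) (z : CSpace n) : bform (c • z) (c • z) = c ^ 2 * bform z z := by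
  rw [bform_smul_left, bform_smul_right]
  ring

lemma bform_toC (x y : RSpace n) : bform (toC x) (toC y) = ((inner ℝ x y : ℝ) : ℂ) := by
  simp [bform, PiLp.inner_apply, mul_comm]

lemma bform_toC_self (x : RSpace n) : bform (toC x) (toC x) = ((‖x‖ ^ 2 : ℝ) : ℂ) := by
  rw [bform_toC, real_inner_self_eq_norm_sq]

/-- `z² = |x|² - |y|² + 2 i ⟨x, y⟩` for `z = x + i y`. -/
lemma bform_add_I_smul (x y : RSpace n) :
    bform (toC x + I • toC y) (toC x + I • toC y) =
      ((‖x‖ ^ 2 - ‖y‖ ^ 2 : ℝ) : ℂ) + ((2 * inner ℝ x y : ℝ) : ℂ) * I := by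
  rw [bform_add_left, bform_add_right, bform_add_right, bform_smul_left, bform_smul_right,
    bform_smul_right, bform_smul_left, bform_toC_self, bform_toC_self, bform_toC, bform_toC,
    real_inner_comm x y]
  push_cast
  linear_combination (‖y‖ : ℂ) ^ 2 * I_mul_I

lemma norm_bform_le (z w : CSpace n) : ‖bform z w‖ ≤ ‖z‖ * ‖w‖ := by
  have h : bform z w = inner ℂ (WithLp.toLp 2 (fun i => (starRingEnd ℂ) (z i)) : CSpace n) w := by
    simp [bform, PiLp.inner_apply, mul_comm]
  have h' : ‖(WithLp.toLp 2 (fun i => (starRingEnd ℂ) (z i)) : CSpace n)‖ = ‖z‖ := by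
    simp [EuclideanSpace.norm_eq]
  rw [h, ← h']
  exact norm_inner_le_norm _ _

@[fun_prop] lemma differentiable_apply (i : Fin n) :
    Differentiable ℂ (fun z : CSpace n => z i) :=
  (EuclideanSpace.proj (𝕜 := ℂ) i : CSpace n →L[ℂ] ℂ).differentiable

@[fun_prop] lemma differentiable_bform_self :
    Differentiable ℂ (fun z : CSpace n => bform z z) := by
  unfold bform
  fun_prop

@[fun_prop] lemma continuous_bform_self : Continuous (fun z : CSpace n => bform z z) :=
  differentiable_bform_self.continuous

/-! ### Holomorphic functions are determined by their values at real points -/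

/-- A holomorphic function on a convex open set that vanishes for small real parameters on a
complex line vanishes on the part of the line in the set. -/
lemma eq_zero_of_eventually_line {E : Type*} [NormedAddCommGroup E] [NormedSpace ℂ E]
    {C : Set E} (hCo : IsOpen C) (hCc : Convex ℝ C) {g : E → ℂ} (hg : DifferentiableOn ℂ g C)
    {p v : E} (hp : p ∈ C) (h : ∀ᶠ t : ℝ in 𝓝 0, g (p + (t : ℂ) • v) = 0) {c : ℂ}
    (hc : p + c • v ∈ C) : g (p + c • v) = 0 := by
  set φ : ℂ → E := fun t => p + t • v with hφ
  have hφd : Differentiable ℂ φ := by fun_prop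
  have hTo : IsOpen (φ ⁻¹' C) := hCo.preimage hφd.continuous
  have hTc : Convex ℝ (φ ⁻¹' C) := by
    intro a ha b hb s t hs ht hst
    have := hCc ha hb hs ht hst
    simp only [mem_preimage, hφ] at this ⊢
    convert! this using 1
    rw [smul_add, smul_add, add_add_add_comm, ← add_smul, hst, one_smul, add_smul, smul_assoc,
      smul_assoc]
  have han : AnalyticOnNhd ℂ (g ∘ φ) (φ ⁻¹' C) :=
    (hg.comp hφd.differentiableOn (mapsTo_preimage φ C)).analyticOnNhd hTo
  refine han.eqOn_zero_of_preconnected_of_frequently_eq_zero (z₀ := 0) hTc.isPreconnected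
    (by simpa [hφ] using hp) ?_ hc
  have h1 : Tendsto (fun t : ℝ => (t : ℂ)) (𝓝[≠] 0) (𝓝[≠] 0) := by
    refine tendsto_nhdsWithin_iff.2 ⟨?_, ?_⟩
    · exact (Complex.continuous_ofReal.tendsto' 0 0 (by simp)).mono_left nhdsWithin_le_nhds
    · filter_upwards [self_mem_nhdsWithin] with t ht
      simpa using ht
  exact h1.frequently (h.filter_mono nhdsWithin_le_nhds).frequently

/-- A holomorphic function on a connected open set that vanishes near one point vanishes. -/
lemma eq_zero_of_eventually {E : Type*} [NormedAddCommGroup E] [NormedSpace ℂ E]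
    {W : Set E} (hWo : IsOpen W) (hWc : IsPreconnected W) {g : E → ℂ}
    (hg : DifferentiableOn ℂ g W) {p : E} (hp : p ∈ W) (h : ∀ᶠ z in 𝓝 p, g z = 0) :
    EqOn g 0 W := by
  set S : Set E := {q | ∀ᶠ z in 𝓝 q, g z = 0} with hS
  have hSo : IsOpen S := isOpen_setOfPred_eventually_nhds
  have hsub : W ⊆ S := by
    refine hWc.subset_of_closure_inter_subset hSo ⟨p, hp, h⟩ ?_
    rintro q ⟨hqS, hqW⟩
    obtain ⟨r, hr, hrW⟩ := Metric.isOpen_iff.1 hWo q hqW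
    obtain ⟨q', hq'S, hq'⟩ := Metric.mem_closure_iff.1 hqS r hr
    have hq'b : q' ∈ Metric.ball q r := by rwa [Metric.mem_ball, dist_comm]
    filter_upwards [Metric.ball_mem_nhds q hr] with z hz
    let _ : NormedSpace ℝ E := NormedSpace.restrictScalars ℝ ℂ E
    have := eq_zero_of_eventually_line (p := q') (v := z - q') (c := 1) Metric.isOpen_ball
      (convex_ball q r) (hg.mono hrW) hq'b ?_ (by simpa using hz)
    · simpa using this
    · have hcont : Tendsto (fun t : ℝ => q' + (t : ℂ) • (z - q')) (𝓝 0) (𝓝 q') := by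
        have : Continuous (fun t : ℝ => q' + (t : ℂ) • (z - q')) := by fun_prop
        exact this.tendsto' 0 q' (by simp)
      exact hcont.eventually hq'S
  intro z hz
  exact (hsub hz).self_of_nhds

/-- Two holomorphic functions on a connected open set that agree at the real points near one real
point agree. -/
theorem eqOn_of_eventually_real {W : Set (CSpace n)} (hWo : IsOpen W) (hWc : IsPreconnected W)
    {g₁ g₂ : CSpace n → ℂ} (h₁ : DifferentiableOn ℂ g₁ W) (h₂ : DifferentiableOn ℂ g₂ W)
    {x₀ : RSpace n} (hx₀ : toC x₀ ∈ W) (h : ∀ᶠ x in 𝓝 x₀, g₁ (toC x) = g₂ (toC x)) :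
    EqOn g₁ g₂ W := by
  have hg : DifferentiableOn ℂ (g₁ - g₂) W := h₁.sub h₂
  suffices H : EqOn (g₁ - g₂) 0 W from fun z hz => sub_eq_zero.1 (H hz)
  refine eq_zero_of_eventually hWo hWc hg hx₀ ?_
  obtain ⟨r, hr, hrW⟩ := Metric.isOpen_iff.1 hWo _ hx₀
  have hre : Tendsto reC (𝓝 (toC x₀)) (𝓝 x₀) :=
    continuous_reC.tendsto' _ _ (by ext i; simp)
  filter_upwards [Metric.ball_mem_nhds _ hr, hre.eventually h.eventually_nhds] with z hz hzr
  -- move from `Re z` in the direction `Im z`, first by small real and then by imaginary amounts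
  have key := eq_zero_of_eventually_line (g := g₁ - g₂) (p := toC (reC z)) (v := toC (imC z))
    (c := I) Metric.isOpen_ball (convex_ball (toC x₀) r) (hg.mono hrW) ?_ ?_ ?_
  · rwa [toC_re_add_im] at key
  · have h1 := norm_sq_re_add_im (z - toC x₀)
    have h2 : reC (z - toC x₀) = reC z - x₀ := by ext i; simp
    have h3 : toC (reC z) - toC x₀ = toC (reC z - x₀) := by ext i; simp
    rw [Metric.mem_ball, dist_eq_norm] at hz ⊢
    rw [h3, norm_toC, ← h2]
    refine lt_of_le_of_lt ?_ hz
    refine le_of_sq_le_sq ?_ (norm_nonneg _)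
    nlinarith [sq_nonneg ‖imC (z - toC x₀)‖]
  · have hcont : Tendsto (fun t : ℝ => reC z + t • imC z) (𝓝 0) (𝓝 (reC z)) := by
      have : Continuous (fun t : ℝ => reC z + t • imC z) := by fun_prop
      exact this.tendsto' 0 _ (by simp)
    filter_upwards [hcont.eventually hzr] with t ht
    rw [← toC_smul, ← toC_add, Pi.sub_apply, ht, sub_self]
  · rwa [toC_re_add_im]

end HarmonicHull

namespace HarmonicHull

open Filter Topology Complex

variable {n : ℕ}

/-! ### The complement of the null cone -/

/-- Two points off the null cone lie on a complex line that meets the null cone in finitely many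
points. -/
lemma isPreconnected_bform_ne_zero : IsPreconnected {z : CSpace n | bform z z ≠ 0} := by
  refine isPreconnected_of_forall_pair fun z hz w hw => ?_
  set φ : ℂ → CSpace n := fun t => z + t • (w - z) with hφ
  set R : Set ℂ := {t | bform (φ t) (φ t) = 0} with hR
  have hfin : R.Finite := by
    set P : Polynomial ℂ := Polynomial.C (bform z z) +
      Polynomial.C (2 * bform z (w - z)) * Polynomial.X +
      Polynomial.C (bform (w - z) (w - z)) * Polynomial.X ^ 2 with hP
    have heval : ∀ t, P.eval t = bform (φ t) (φ t) := by
      intro t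
      simp only [hP, hφ, Polynomial.eval_add, Polynomial.eval_mul, Polynomial.eval_C,
        Polynomial.eval_X, Polynomial.eval_pow, bform_add_left, bform_add_right, bform_smul_left,
        bform_smul_right]
      rw [bform_comm (w - z) z]
      ring
    have hP0 : P ≠ 0 := by
      intro h0
      have := heval 0
      rw [h0] at this
      simp only [Polynomial.eval_zero, hφ, zero_smul, add_zero] at this
      exact hz this.symm
    refine (Polynomial.finite_setOfPred_isRoot hP0).subset fun t ht => ?_
    rw [mem_ofPred_eq, Polynomial.IsRoot, heval]
    exact ht
  have hconn : IsPreconnected Rᶜ :=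
    (hfin.countable.isConnected_compl_of_one_lt_rank
      (by rw [Complex.rank_real_complex]; norm_num)).isPreconnected
  have hφc : Continuous φ := by fun_prop
  refine ⟨φ '' Rᶜ, ?_, ⟨0, ?_, ?_⟩, ⟨1, ?_, ?_⟩, hconn.image φ hφc.continuousOn⟩
  · rintro _ ⟨t, ht, rfl⟩
    exact ht
  · simpa [hR, hφ] using hz
  · simp [hφ]
  · simpa [hR, hφ] using hw
  · simp [hφ]

lemma bform_toC_self_ne_zero {x : RSpace n} (hx : x ≠ 0) : bform (toC x) (toC x) ≠ 0 := by
  rw [bform_toC_self]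
  exact_mod_cast (pow_pos (norm_pos_iff.2 hx) 2).ne'

theorem tildeHull_compl_zero (hn : 0 < n) :
    tildeHull ({0}ᶜ : Set (RSpace n)) = {z | bform z z ≠ 0} := by
  have hset : (⋃ y ∈ ({0}ᶜ : Set (RSpace n))ᶜ, isotropicCone (toC y))ᶜ =
      {z : CSpace n | bform z z ≠ 0} := by
    ext z
    simp [isotropicCone]
  have hx : ∀ x ∈ ({0}ᶜ : Set (RSpace n)),
      connectedComponentIn {z : CSpace n | bform z z ≠ 0} (toC x) = {z | bform z z ≠ 0} :=
    fun x hx => isPreconnected_bform_ne_zero.connectedComponentIn (bform_toC_self_ne_zero hx)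
  rw [tildeHull, hset]
  have : Nonempty (Fin n) := ⟨⟨0, hn⟩⟩
  obtain ⟨x, hx0⟩ := exists_ne (0 : RSpace n)
  refine subset_antisymm (iUnion₂_subset fun y hy => (hx y hy).subset) ?_
  exact (hx x hx0).superset.trans (subset_iUnion₂_of_subset x hx0 subset_rfl)

/-! ### Extensions of the Newtonian potential -/

lemma newtonian_sq_mul (x : RSpace n) (hx : x ≠ 0) :
    newtonian n x ^ 2 * bform (toC x) (toC x) ^ (n - 2) = 1 := by
  have h : ‖x‖ ≠ 0 := norm_ne_zero_iff.2 hx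
  rw [bform_toC_self, newtonian]
  norm_cast
  rw [← pow_mul, mul_comm 2, pow_mul, ← mul_pow, inv_mul_cancel₀ (pow_ne_zero _ h), one_pow]

/-- The square of an extension of the Newtonian potential inverts a power of `z²`, so that an
extension domain avoids the null cone. -/
theorem IsExtensionDomain.subset_of_harmonic_newtonian (hn : 3 ≤ n) {W : Set (CSpace n)}
    (hN : InnerProductSpace.HarmonicOnNhd (newtonian n) ({0}ᶜ : Set (RSpace n)))
    (hW : IsExtensionDomain ({0}ᶜ : Set (RSpace n)) W) : W ⊆ {z | bform z z ≠ 0} := by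
  obtain ⟨g, hg, hgN⟩ := hW.extends_harmonic _ hN
  obtain ⟨x₀, hx₀, hx₀W⟩ := hW.meets
  have key : EqOn (fun z => g z ^ 2 * bform z z ^ (n - 2)) (fun _ => 1) W := by
    refine eqOn_of_eventually_real hW.isOpen hW.isConnected.isPreconnected ?_ ?_ hx₀W ?_
    · exact (hg.pow 2).mul (differentiable_bform_self.pow (n - 2)).differentiableOn
    · exact differentiableOn_const 1
    · filter_upwards [continuous_toC.continuousAt.eventually (hW.isOpen.mem_nhds hx₀W),
        isOpen_compl_singleton.mem_nhds hx₀] with x hxW hx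
      rw [hgN x hx hxW, newtonian_sq_mul x hx]
  intro z hz h0
  have := key hz
  simp only [h0] at this
  rw [zero_pow (by omega), mul_zero] at this
  exact zero_ne_one this

/-- On the punctured complex line through `e₁` an extension of the Newtonian potential is
`t ^ (2 - n)`, because it is so for `t > 0`. For odd `n` it has the wrong sign at `t = -1`. -/
theorem not_extendsTo_newtonian [NeZero n] (hodd : Odd n) (hn : 3 ≤ n) :
    ¬ ExtendsTo ({0}ᶜ : Set (RSpace n)) (newtonian n) {z | bform z z ≠ 0} := by
  rintro ⟨g, hg, hgN⟩
  have he : ‖e₁ n‖ = 1 := by simp [e₁]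
  have he0 : e₁ n ≠ 0 := fun h => by simp [h] at he
  set φ : ℂ → CSpace n := fun t => t • toC (e₁ n) with hφ
  have hφd : Differentiable ℂ φ := by fun_prop
  have hmaps : MapsTo φ {0}ᶜ {z | bform z z ≠ 0} := by
    intro t ht
    simp only [hφ, mem_ofPred_eq, bform_smul_self]
    exact mul_ne_zero (pow_ne_zero 2 ht) (bform_toC_self_ne_zero he0)
  have hreal : ∀ t : ℝ, t ≠ 0 → g (φ t) = (((|t| ^ (n - 2))⁻¹ : ℝ) : ℂ) := by
    intro t ht
    have hne : t • e₁ n ≠ 0 := smul_ne_zero ht he0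
    have h := hgN (t • e₁ n) hne (bform_toC_self_ne_zero hne)
    rw [toC_smul] at h
    simp only [hφ, h, newtonian, norm_smul, he, mul_one, Real.norm_eq_abs]
  have key : EqOn (fun t : ℂ => g (φ t) * t ^ (n - 2) - 1) 0 {0}ᶜ := by
    have han : AnalyticOnNhd ℂ (fun t : ℂ => g (φ t) * t ^ (n - 2) - 1) {0}ᶜ := by
      refine DifferentiableOn.analyticOnNhd ?_ isOpen_compl_singleton
      exact ((hg.comp hφd.differentiableOn hmaps).mul
        (differentiable_id.pow (n - 2)).differentiableOn).sub_const 1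
    refine han.eqOn_zero_of_preconnected_of_frequently_eq_zero (z₀ := 1) ?_ (by simp) ?_
    · exact (isConnected_compl_singleton_of_one_lt_rank
        (by rw [Complex.rank_real_complex]; norm_num) 0).isPreconnected
    · have h1 : Tendsto (fun t : ℝ => (t : ℂ)) (𝓝[≠] 1) (𝓝[≠] 1) := by
        refine tendsto_nhdsWithin_iff.2 ⟨?_, ?_⟩
        · exact (Complex.continuous_ofReal.tendsto' 1 1 (by simp)).mono_left nhdsWithin_le_nhds
        · filter_upwards [self_mem_nhdsWithin] with t ht
          simpa using ht
      refine h1.frequently (Eventually.frequently ?_)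
      filter_upwards [nhdsWithin_le_nhds (Ioi_mem_nhds (show (0 : ℝ) < 1 by norm_num))] with t ht
      have ht' : t ≠ 0 := (mem_Ioi.1 ht).ne'
      rw [hreal t ht', abs_of_pos (mem_Ioi.1 ht)]
      push_cast
      rw [inv_mul_cancel₀ (pow_ne_zero _ (by exact_mod_cast ht')), sub_self]
  have h1 := key (show (-1 : ℂ) ∈ ({0}ᶜ : Set ℂ) by simp)
  have h2 := hreal (-1) (by norm_num)
  have hodd' : Odd (n - 2) := by
    obtain ⟨k, hk⟩ := hodd
    exact ⟨k - 1, by omega⟩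
  push_cast at h2
  simp only [h2, hodd'.neg_one_pow] at h1
  norm_num at h1

end HarmonicHull

namespace HarmonicHull

open Filter Topology MeasureTheory Laplacian InnerProductSpace Module

/-! ### The Laplacian of powers of the distance -/

section Laplacian

variable {E : Type*} [NormedAddCommGroup E] [InnerProductSpace ℝ E]

/-- The power `(‖y - x‖² + t) ^ s`, regarded as a function of `y`. With `2 s = 2 - dim E` this is
the Newtonian potential centred at `x` for `t = 0`, and a smooth regularization of it for
`t > 0`. -/
noncomputable def distPow (s t : ℝ) (x y : E) : ℝ := (‖y - x‖ ^ 2 + t) ^ s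

lemma contDiffAt_distPow {s t : ℝ} {x y : E}
    (h : ‖y - x‖ ^ 2 + t ≠ 0) :
    ContDiffAt ℝ 2 (distPow s t x) y := by
  unfold distPow
  refine ContDiffAt.rpow_const_of_ne ?_ h
  exact (((contDiff_id.sub contDiff_const).norm_sq ℝ).add contDiff_const).contDiffAt

lemma hasFDerivAt_distPow {s t : ℝ} {x y : E} (h : ‖y - x‖ ^ 2 + t ≠ 0) :
    HasFDerivAt (distPow s t x) ((2 * s * distPow (s - 1) t x y) • innerSL ℝ (y - x)) y := by
  have h1 : HasFDerivAt (fun y : E => ‖y - x‖ ^ 2 + t) ((2 : ℝ) • innerSL ℝ (y - x)) y := by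
    have := ((hasFDerivAt_id y).sub_const x).norm_sq.add_const t
    convert! this using 1
    ext v
    simp
  have h2 := h1.rpow_const (p := s) (Or.inl h)
  convert! h2 using 1
  rw [smul_smul, distPow]
  ring_nf

lemma eventually_ne_distPow {E : Type*} [NormedAddCommGroup E] {t : ℝ} {x y : E}
    (h : ‖y - x‖ ^ 2 + t ≠ 0) :
    ∀ᶠ w in 𝓝 y, ‖w - x‖ ^ 2 + t ≠ 0 := by
  have : Continuous fun w : E => ‖w - x‖ ^ 2 + t := by fun_prop
  exact this.continuousAt.eventually_ne h

lemma fderiv_fderiv_distPow {s t : ℝ} {x y : E} (h : ‖y - x‖ ^ 2 + t ≠ 0) (e : E) :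
    fderiv ℝ (fderiv ℝ (distPow s t x)) y e e =
      2 * s * (2 * (s - 1) * distPow (s - 2) t x y * inner ℝ (y - x) e ^ 2 +
        distPow (s - 1) t x y * ‖e‖ ^ 2) := by
  obtain ⟨D, hDi, hD⟩ : ∃ D : E →L[ℝ] E →L[ℝ] ℝ, (∀ v, D v = innerSL ℝ v) ∧
    ∀ v w, D v w = inner ℝ v w := ⟨innerSL ℝ, fun _ => rfl, fun _ _ => rfl⟩
  have h1 : fderiv ℝ (distPow s t x) =ᶠ[𝓝 y]
      fun y => (2 * s * distPow (s - 1) t x y) • D (y - x) := by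
    filter_upwards [eventually_ne_distPow h] with w hw
    rw [hDi]
    exact (hasFDerivAt_distPow hw).fderiv
  rw [h1.fderiv_eq]
  have h2 : HasFDerivAt (fun y : E => D (y - x)) D y :=
    D.hasFDerivAt.comp y ((hasFDerivAt_id y).sub_const x)
  have h3 := ((hasFDerivAt_distPow (s := s - 1) h).const_mul (2 * s)).smul h2
  refine (congrArg (fun L : E →L[ℝ] E →L[ℝ] ℝ => L e e) h3.fderiv).trans ?_
  have h5 : s - 1 - 1 = s - 2 := by ring
  simp only [_root_.add_apply, _root_.smul_apply, ContinuousLinearMap.smulRight_apply, smul_eq_mul,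
    h5, hD, innerSL_apply_apply, real_inner_self_eq_norm_sq]
  ring

variable [FiniteDimensional ℝ E]

lemma laplacian_eq_sum_fderiv {F : Type*} [NormedAddCommGroup F] [NormedSpace ℝ F] (f : E → F)
    (y : E) : Δ f y = ∑ i, fderiv ℝ (fderiv ℝ f) y (stdOrthonormalBasis ℝ E i)
      (stdOrthonormalBasis ℝ E i) := by
  rw [laplacian_eq_iteratedFDeriv_stdOrthonormalBasis]
  simp [iteratedFDeriv_two_apply]

/-- The Laplacian of the regularized Newtonian potential. It vanishes for `t = 0`, and for small
`t > 0` it is a peak at `x`. -/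
lemma laplacian_distPow {s t : ℝ} {x y : E} (hs : 2 * s = 2 - finrank ℝ E)
    (h : ‖y - x‖ ^ 2 + t ≠ 0) :
    Δ (distPow s t x) y = -(finrank ℝ E * (finrank ℝ E - 2)) * (t * distPow (s - 2) t x y) := by
  have hstep : distPow (s - 1) t x y = (‖y - x‖ ^ 2 + t) * distPow (s - 2) t x y := by
    have h5 : s - 1 = s - 2 + 1 := by ring
    rw [distPow, distPow, h5, Real.rpow_add_one h, mul_comm]
  have hsum : ∑ i, inner ℝ (y - x) (stdOrthonormalBasis ℝ E i) ^ 2 = ‖y - x‖ ^ 2 := by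
    rw [← (stdOrthonormalBasis ℝ E).sum_sq_norm_inner_left (y - x)]
    simp
  have hd : (finrank ℝ E : ℝ) = 2 - 2 * s := by linarith
  rw [laplacian_eq_sum_fderiv]
  simp only [fderiv_fderiv_distPow h]
  simp only [OrthonormalBasis.norm_eq_one, one_pow, mul_one, ← Finset.mul_sum,
    Finset.sum_add_distrib, Finset.sum_const, Finset.card_univ, Fintype.card_fin, nsmul_eq_mul]
  rw [hsum, hd, hstep]
  ring

/-! ### Green's identity and the fundamental solution -/

variable [MeasurableSpace E] [BorelSpace E]

/-- Green's second identity for a compactly supported function. -/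
theorem integral_smul_laplacian_eq {f : E → ℝ} {g : E → ℂ} (hf : ContDiff ℝ 2 f)
    (hg : ContDiff ℝ 2 g) (hc : HasCompactSupport g) :
    ∫ y, f y • Δ g y = ∫ y, Δ f y • g y := by
  have hf1 : ContDiff ℝ 1 (fderiv ℝ f) := hf.fderiv_right (by norm_num)
  have hg1 : ContDiff ℝ 1 (fderiv ℝ g) := hg.fderiv_right (by norm_num)
  have hc1 : HasCompactSupport (fderiv ℝ g) := hc.fderiv (𝕜 := ℝ)
  have hc2 : HasCompactSupport (fderiv ℝ (fderiv ℝ g)) := hc1.fderiv (𝕜 := ℝ)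
  have hf2 : Continuous (fderiv ℝ (fderiv ℝ f)) := hf1.continuous_fderiv (by norm_num)
  have hg2 : Continuous (fderiv ℝ (fderiv ℝ g)) := hg1.continuous_fderiv (by norm_num)
  have hf0 : Continuous f := hf.continuous
  have hg0 : Continuous g := hg.continuous
  have hf1c : Continuous (fderiv ℝ f) := hf1.continuous
  have hg1c : Continuous (fderiv ℝ g) := hg1.continuous
  have hA : ∀ e : E, Integrable (fun y => f y • fderiv ℝ (fderiv ℝ g) y e e) := fun e => by
    refine Continuous.integrable_of_hasCompactSupport (by fun_prop) ?_
    exact hc2.mono fun y hy h0 => hy (by simp [h0])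
  have hB : ∀ e : E, Integrable (fun y => fderiv ℝ f y e • fderiv ℝ g y e) := fun e => by
    refine Continuous.integrable_of_hasCompactSupport (by fun_prop) ?_
    exact hc1.mono fun y hy h0 => hy (by simp [h0])
  have hB' : ∀ e : E, Integrable (fun y => f y • fderiv ℝ g y e) := fun e => by
    refine Continuous.integrable_of_hasCompactSupport (by fun_prop) ?_
    exact hc1.mono fun y hy h0 => hy (by simp [h0])
  have hC : ∀ e : E, Integrable (fun y => fderiv ℝ (fderiv ℝ f) y e e • g y) := fun e => by
    refine Continuous.integrable_of_hasCompactSupport (by fun_prop) ?_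
    exact hc.mono fun y hy h0 => hy (by simp [h0])
  have hC' : ∀ e : E, Integrable (fun y => fderiv ℝ f y e • g y) := fun e => by
    refine Continuous.integrable_of_hasCompactSupport (by fun_prop) ?_
    exact hc.mono fun y hy h0 => hy (by simp [h0])
  have hdf : ∀ e y, fderiv ℝ (fun w => fderiv ℝ f w e) y = (fderiv ℝ (fderiv ℝ f) y).flip e :=
    fun e y => by
      rw [fderiv_clm_apply (hf1.differentiable (by norm_num) y) (differentiableAt_const e)]
      simp
  have hdg : ∀ e y, fderiv ℝ (fun w => fderiv ℝ g w e) y = (fderiv ℝ (fderiv ℝ g) y).flip e :=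
    fun e y => by
      rw [fderiv_clm_apply (hg1.differentiable (by norm_num) y) (differentiableAt_const e)]
      simp
  have hdf' : ∀ e, Differentiable ℝ (fun w => fderiv ℝ f w e) := fun e =>
    (hf1.differentiable (by norm_num)).clm_apply (differentiable_const e)
  have hdg' : ∀ e, Differentiable ℝ (fun w => fderiv ℝ g w e) := fun e =>
    (hg1.differentiable (by norm_num)).clm_apply (differentiable_const e)
  have hmain : ∀ e : E, ∫ y, f y • fderiv ℝ (fderiv ℝ g) y e e =
      ∫ y, fderiv ℝ (fderiv ℝ f) y e e • g y := fun e => by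
    have h1 := integral_smul_fderiv_eq_neg_fderiv_smul_of_integrable (μ := volume) (f := f)
      (g := fun y => fderiv ℝ g y e) (v := e) (hB e) (by simpa [hdg] using hA e) (hB' e)
      (fun y _ => hf.differentiable (by norm_num) y) (fun y _ => hdg' e y)
    have h2 := integral_smul_fderiv_eq_neg_fderiv_smul_of_integrable (μ := volume)
      (f := fun y => fderiv ℝ f y e) (g := g) (v := e) (by simpa [hdf] using hC e) (hB e) (hC' e)
      (fun y _ => hdf' e y) (fun y _ => hg.differentiable (by norm_num) y)
    simp only [hdg, hdf, ContinuousLinearMap.flip_apply] at h1 h2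
    rw [h1, h2, neg_neg]
  simp only [laplacian_eq_sum_fderiv, Finset.smul_sum, Finset.sum_smul]
  rw [integral_finsetSum _ fun i _ => hA _, integral_finsetSum _ fun i _ => hC _]
  exact Finset.sum_congr rfl fun i _ => hmain _

lemma tendsto_integral_distPow {s : ℝ} (hs : s ≤ 0) {ψ : E → ℂ} (hψ : Integrable ψ) {x : E}
    (hx : ∀ᶠ y in 𝓝 x, ψ y = 0) :
    Tendsto (fun c : ℝ => ∫ y, distPow s (c⁻¹ ^ 2) x y • ψ y) atTop
      (𝓝 (∫ y, distPow s 0 x y • ψ y)) := by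
  obtain ⟨r, hr, hrψ⟩ := Metric.eventually_nhds_iff.1 hx
  refine tendsto_integral_filter_of_dominated_convergence (fun y => (r ^ 2) ^ s * ‖ψ y‖) ?_ ?_
    (hψ.norm.const_mul _) ?_
  · refine Eventually.of_forall fun c => ?_
    have : Measurable fun y : E => distPow s (c⁻¹ ^ 2) x y := by
      unfold distPow
      fun_prop
    exact this.aestronglyMeasurable.smul hψ.aestronglyMeasurable
  · refine Eventually.of_forall fun c => Eventually.of_forall fun y => ?_
    by_cases hy : dist y x < r
    · simp [hrψ hy]
    · rw [norm_smul]
      refine mul_le_mul_of_nonneg_right ?_ (norm_nonneg _)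
      rw [not_lt, dist_eq_norm] at hy
      have h1 : r ^ 2 ≤ ‖y - x‖ ^ 2 + c⁻¹ ^ 2 := by
        nlinarith [sq_nonneg (c⁻¹), pow_le_pow_left₀ hr.le hy 2]
      rw [distPow, Real.norm_of_nonneg (by positivity)]
      exact Real.rpow_le_rpow_of_nonpos (by positivity) h1 hs
  · refine Eventually.of_forall fun y => ?_
    by_cases hy : y = x
    · simp [hy, hx.self_of_nhds]
    · refine Tendsto.smul_const ?_ _
      unfold distPow
      have hne : ‖y - x‖ ^ 2 + 0 ≠ 0 := by
        rw [add_zero]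
        exact pow_ne_zero 2 (norm_ne_zero_iff.2 (sub_ne_zero.2 hy))
      refine Tendsto.rpow_const (tendsto_const_nhds.add ?_) (Or.inl hne)
      simpa using (tendsto_inv_atTop_zero (𝕜 := ℝ)).pow 2

/-- The Newtonian potential is a fundamental solution of the Laplacian: its integral against `Δ v`
is a constant multiple of the value of `v` at the centre, if `v` is harmonic there. -/
theorem exists_integral_distPow_smul_laplacian (hE : 3 ≤ finrank ℝ E) :
    ∃ c : ℝ, c ≠ 0 ∧ ∀ (v : E → ℂ) (x : E), ContDiff ℝ 2 v → HasCompactSupport v →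
      Δ v =ᶠ[𝓝 x] 0 →
        ∫ y, distPow (-((finrank ℝ E - 2 : ℝ) / 2)) 0 x y • Δ v y = c • v x := by
  set d : ℝ := (finrank ℝ E : ℝ) with hd
  have hd3 : 3 ≤ d := by
    rw [hd]
    exact_mod_cast hE
  set s : ℝ := -((d - 2) / 2) with hs
  set φ₀ : E → ℝ := fun w => (1 + ‖w‖ ^ 2) ^ (-(d + 2) / 2) with hφ₀
  have hint : Integrable φ₀ := integrable_rpow_neg_one_add_norm_sq (by rw [← hd]; linarith)
  set J : ℝ := ∫ w, φ₀ w with hJ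
  have hJpos : 0 < J := by
    refine (integral_pos_iff_support_of_nonneg (fun w => by positivity) hint).2 ?_
    have : Function.support φ₀ = univ := by
      refine eq_univ_of_forall fun w => ?_
      have : 0 < φ₀ w := by positivity
      exact this.ne'
    rw [this]
    exact Measure.measure_univ_pos.2 (NeZero.ne _)
  refine ⟨-(d * (d - 2)) * J, by
    have : 0 < d * (d - 2) * J := by
      have : 0 < d - 2 := by linarith
      positivity
    linarith, fun v x hv hvc hvx => ?_⟩
  have hlapc : Continuous (Δ v) := by
    have h1 : Continuous (fderiv ℝ (fderiv ℝ v)) :=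
      (hv.fderiv_right (m := 1) (by norm_num)).continuous_fderiv (by norm_num)
    have : Δ v = fun y => ∑ i, fderiv ℝ (fderiv ℝ v) y (stdOrthonormalBasis ℝ E i)
      (stdOrthonormalBasis ℝ E i) := funext (laplacian_eq_sum_fderiv v)
    rw [this]
    fun_prop
  have hlapi : Integrable (Δ v) := by
    refine hlapc.integrable_of_hasCompactSupport ?_
    have h2 : HasCompactSupport (fderiv ℝ (fderiv ℝ v)) :=
      (hvc.fderiv (𝕜 := ℝ)).fderiv (𝕜 := ℝ)
    exact h2.mono fun y hy h0 => hy (by simp [laplacian_eq_sum_fderiv, h0])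
  have hlim1 := tendsto_integral_distPow (s := s) (by rw [hs]; linarith) hlapi hvx
  have hdecay : Tendsto (fun w : E => ‖w‖ ^ finrank ℝ E * (J⁻¹ * φ₀ w)) (Bornology.cobounded E)
      (𝓝 0) := by
    have h1 : Tendsto (fun w : E => J⁻¹ * (1 + ‖w‖ ^ 2)⁻¹) (Bornology.cobounded E) (𝓝 0) := by
      have h2 : Tendsto (fun w : E => 1 + ‖w‖ ^ 2) (Bornology.cobounded E) atTop :=
        tendsto_atTop_add_const_left _ _
          ((tendsto_pow_atTop two_ne_zero).comp tendsto_norm_cobounded_atTop)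
      simpa using (tendsto_inv_atTop_zero.comp h2).const_mul J⁻¹
    refine squeeze_zero (fun w => by positivity) (fun w => ?_) h1
    have hb : (0 : ℝ) < 1 + ‖w‖ ^ 2 := by positivity
    have h3 : ‖w‖ ^ finrank ℝ E ≤ (1 + ‖w‖ ^ 2) ^ (d / 2) := by
      have h4 : ‖w‖ ^ finrank ℝ E = (‖w‖ ^ 2) ^ (d / 2) := by
        rw [← Real.rpow_natCast ‖w‖ 2, ← Real.rpow_mul (norm_nonneg _), ← Real.rpow_natCast]
        congr 1
        push_cast
        ring
      rw [h4]
      exact Real.rpow_le_rpow (by positivity) (by linarith) (by linarith)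
    have h5 : (1 + ‖w‖ ^ 2) ^ (d / 2) * φ₀ w = (1 + ‖w‖ ^ 2)⁻¹ := by
      rw [hφ₀, ← Real.rpow_add hb, ← Real.rpow_neg_one]
      congr 1
      ring
    calc ‖w‖ ^ finrank ℝ E * (J⁻¹ * φ₀ w) = J⁻¹ * (‖w‖ ^ finrank ℝ E * φ₀ w) := by ring
      _ ≤ J⁻¹ * ((1 + ‖w‖ ^ 2) ^ (d / 2) * φ₀ w) := by gcongr
      _ = J⁻¹ * (1 + ‖w‖ ^ 2)⁻¹ := by rw [h5]
  have hlim2 := tendsto_integral_comp_smul_smul_of_integrable' (μ := (volume : Measure E))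
    (φ := fun w => J⁻¹ * φ₀ w) (fun w => by positivity)
    (by rw [integral_const_mul, ← hJ, inv_mul_cancel₀ hJpos.ne']) hdecay (g := v) (x₀ := x)
    (hv.continuous.integrable_of_hasCompactSupport hvc) hv.continuous.continuousAt
  have hlim3 := hlim2.const_smul (-(d * (d - 2)) * J)
  refine tendsto_nhds_unique (hlim1.congr' ?_) hlim3
  filter_upwards [eventually_gt_atTop 0] with c hc
  have hci : 0 < c⁻¹ ^ 2 := by positivity
  have hne : ∀ y : E, ‖y - x‖ ^ 2 + c⁻¹ ^ 2 ≠ 0 := fun y => by positivity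
  rw [integral_smul_laplacian_eq
    (contDiff_iff_contDiffAt.2 fun y => contDiffAt_distPow (hne y)) hv hvc, ← integral_smul]
  refine integral_congr_ae (Eventually.of_forall fun y => ?_)
  simp only
  rw [laplacian_distPow (by rw [hs]; ring) (hne y), smul_smul]
  congr 1
  -- `‖y - x‖² + c⁻² = c⁻² (1 + ‖c (x - y)‖²)`, and the powers of `c` add up to `c ^ dim E`
  have h6 : ‖y - x‖ ^ 2 + c⁻¹ ^ 2 = c⁻¹ ^ 2 * (1 + ‖c • (x - y)‖ ^ 2) := by
    rw [norm_smul, Real.norm_of_nonneg hc.le, norm_sub_rev]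
    field_simp
    ring
  have h7 : c⁻¹ ^ 2 * (c⁻¹ ^ 2) ^ (s - 2) = c ^ finrank ℝ E := by
    rw [← Real.rpow_natCast c⁻¹ 2, ← Real.rpow_mul (by positivity), ← Real.rpow_add (by positivity),
      Real.inv_rpow hc.le, ← Real.rpow_neg hc.le, ← Real.rpow_natCast c]
    congr 1
    rw [hs, ← hd]
    push_cast
    ring
  have h8 : s - 2 = -(d + 2) / 2 := by rw [hs]; ring
  rw [distPow, h6, Real.mul_rpow hci.le (by positivity), ← mul_assoc (c⁻¹ ^ 2), h7, h8, ← hd]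
  have h9 : J * J⁻¹ = 1 := mul_inv_cancel₀ hJpos.ne'
  linear_combination
    (d * (d - 2)) * (c ^ finrank ℝ E * (1 + ‖c • (x - y)‖ ^ 2) ^ (-(d + 2) / 2)) * h9

end Laplacian

/-! ### Harmonicity of the Newtonian potential -/

lemma inv_pow_eq_rpow {n : ℕ} (hn : 2 ≤ n) {r : ℝ} (hr : 0 ≤ r) :
    (r ^ (n - 2))⁻¹ = (r ^ 2) ^ (-((n - 2 : ℝ) / 2)) := by
  rw [Real.rpow_neg (by positivity), ← Real.rpow_natCast r 2, ← Real.rpow_mul hr,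
    ← Real.rpow_natCast]
  congr 2
  push_cast [hn]
  ring

theorem harmonicOnNhd_newtonian {n : ℕ} (hn : 2 ≤ n) :
    HarmonicOnNhd (newtonian n) ({0}ᶜ : Set (RSpace n)) := by
  intro x hx
  set s : ℝ := -((n - 2 : ℝ) / 2) with hs
  have hfun : newtonian n = Complex.ofRealCLM ∘ distPow s 0 (0 : RSpace n) := by
    ext y
    simp only [newtonian, Function.comp_apply, Complex.ofRealCLM_apply, distPow, sub_zero, add_zero,
      inv_pow_eq_rpow hn (norm_nonneg y), hs]
  have hne : ‖x - 0‖ ^ 2 + 0 ≠ 0 := by simpa using hx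
  rw [hfun]
  refine HarmonicAt.comp_CLM ⟨contDiffAt_distPow hne, ?_⟩ _
  filter_upwards [eventually_ne_distPow hne] with y hy
  rw [laplacian_distPow (by rw [hs, finrank_euclideanSpace_fin]; ring) hy]
  simp

end HarmonicHull

namespace HarmonicHull

open Filter Topology MeasureTheory Laplacian InnerProductSpace Module

variable {n : ℕ}

/-! ### Holomorphic integrals of the Newtonian potential -/

/-- The bilinear form as a continuous bilinear map. -/
noncomputable def bformL (n : ℕ) : CSpace n →L[ℂ] CSpace n →L[ℂ] ℂ :=
  (LinearMap.mk₂ ℂ bform bform_add_left bform_smul_left bform_add_right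
    bform_smul_right).mkContinuous₂ 1 fun z w => by
      simpa using norm_bform_le z w

@[simp] lemma bformL_apply (z w : CSpace n) : bformL n z w = bform z w := rfl

lemma norm_bformL_apply_le (z : CSpace n) : ‖bformL n z‖ ≤ ‖z‖ :=
  ContinuousLinearMap.opNorm_le_bound _ (norm_nonneg z) (norm_bform_le z)

/-- The polynomial `1 - 2 ⟨ξ, y⟩ + ξ² ‖y‖²`, which is `‖y - x‖² / ‖x‖²` if `ξ = x / ‖x‖²` for a real
point `x`, and `‖ξ - x‖² / ‖x‖²` if `ξ` is real and `y = x / ‖x‖²`. -/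
noncomputable def kelvinPoly (ξ : CSpace n) (y : RSpace n) : ℂ :=
  1 - 2 * bform ξ (toC y) + bform ξ ξ * (‖y‖ ^ 2 : ℝ)

lemma norm_kelvinPoly_sub_one_le (ξ : CSpace n) (y : RSpace n) :
    ‖kelvinPoly ξ y - 1‖ ≤ 2 * (‖ξ‖ * ‖y‖) + (‖ξ‖ * ‖y‖) ^ 2 := by
  have h : kelvinPoly ξ y - 1 = -(2 * bform ξ (toC y)) + bform ξ ξ * (‖y‖ ^ 2 : ℝ) := by
    rw [kelvinPoly]
    ring
  have h1 : ‖bform ξ (toC y)‖ ≤ ‖ξ‖ * ‖y‖ := by simpa using norm_bform_le ξ (toC y)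
  have h2 : ‖bform ξ ξ‖ ≤ ‖ξ‖ * ‖ξ‖ := norm_bform_le ξ ξ
  rw [h]
  refine (norm_add_le _ _).trans ?_
  rw [norm_neg, norm_mul, norm_mul, Complex.norm_real, Complex.norm_ofNat,
    Real.norm_of_nonneg (by positivity)]
  have h3 := mul_le_mul_of_nonneg_right h2 (sq_nonneg ‖y‖)
  nlinarith

lemma re_kelvinPoly_gt {ξ : CSpace n} {y : RSpace n} (h : 3 * (‖ξ‖ * ‖y‖) < 1) :
    2 / 9 < (kelvinPoly ξ y).re := by
  have h1 := norm_kelvinPoly_sub_one_le ξ y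
  have h2 := (abs_le.1 (Complex.abs_re_le_norm (kelvinPoly ξ y - 1))).1
  have h3 : 0 ≤ ‖ξ‖ * ‖y‖ := by positivity
  rw [Complex.sub_re, Complex.one_re] at h2
  nlinarith

lemma hasFDerivAt_kelvinPoly (ξ : CSpace n) (y : RSpace n) :
    HasFDerivAt (fun ξ => kelvinPoly ξ y)
      ((-2 : ℂ) • bformL n (toC y) + (2 * (‖y‖ ^ 2 : ℝ) : ℂ) • bformL n ξ) ξ := by
  have h1 : HasFDerivAt (fun ξ => bform ξ (toC y)) (bformL n (toC y)) ξ := by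
    have : (fun ξ => bform ξ (toC y)) = bformL n (toC y) := funext fun ξ => bform_comm _ _
    rw [this]
    exact (bformL n (toC y)).hasFDerivAt
  have h2 := (bformL n).hasFDerivAt_of_bilinear (hasFDerivAt_id ξ) (hasFDerivAt_id ξ)
  have h3 := ((h1.const_mul 2).const_sub 1).add (h2.mul_const ((‖y‖ ^ 2 : ℝ) : ℂ))
  refine h3.congr_fderiv ?_
  ext v
  simp [bform_comm v ξ]
  ring

lemma continuous_kelvinPoly (ξ : CSpace n) : Continuous (kelvinPoly ξ) := by
  unfold kelvinPoly
  have h : Continuous fun y : RSpace n => bform ξ (toC y) :=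
    (bformL n ξ).continuous.comp continuous_toC
  fun_prop

/-- The integral of powers of `kelvinPoly` against a function depends holomorphically on the
complex vector, as long as the power stays away from the branch cut. -/
lemma differentiableOn_integral_kelvinPoly {s : ℝ} (hs : s ≤ 1) {a : RSpace n → ℂ}
    (ha : Integrable a) {b : RSpace n → RSpace n} (hb : Measurable b) {M : ℝ} (hM : 0 < M)
    (hab : ∀ y, a y ≠ 0 → ‖b y‖ ≤ M) :
    DifferentiableOn ℂ (fun ξ => ∫ y, a y * kelvinPoly ξ (b y) ^ (s : ℂ))
      (Metric.ball 0 (3 * M)⁻¹) := by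
  intro ξ₀ hξ₀
  refine DifferentiableAt.differentiableWithinAt ?_
  set F' : CSpace n → RSpace n → CSpace n →L[ℂ] ℂ := fun ξ y =>
    a y • ((s : ℂ) * kelvinPoly ξ (b y) ^ ((s : ℂ) - 1)) •
      ((-2 : ℂ) • bformL n (toC (b y)) + (2 * (‖b y‖ ^ 2 : ℝ) : ℂ) • bformL n ξ) with hF'
  have hF'0 : ∀ ξ y, a y = 0 → F' ξ y = 0 := fun ξ y hy => by
    simp only [hF', hy]
    exact zero_smul ℂ (_ : CSpace n →L[ℂ] ℂ)
  have hball : ∀ ξ ∈ Metric.ball (0 : CSpace n) (3 * M)⁻¹, ∀ y, a y ≠ 0 →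
      3 * (‖ξ‖ * ‖b y‖) < 1 := by
    intro ξ hξ y hy
    have h1 : ‖ξ‖ < (3 * M)⁻¹ := by simpa using hξ
    have h2 : ‖ξ‖ * (3 * M) < 1 := by
      have := mul_lt_mul_of_pos_right h1 (by positivity : 0 < 3 * M)
      rwa [inv_mul_cancel₀ (by positivity)] at this
    have h3 := mul_le_mul_of_nonneg_left (hab y hy) (norm_nonneg ξ)
    linarith
  have hmeas : ∀ ξ, Measurable fun y => kelvinPoly ξ (b y) := fun ξ =>
    (continuous_kelvinPoly ξ).measurable.comp hb
  have hmeas1 : ∀ ξ (r : ℂ), AEStronglyMeasurable (fun y => kelvinPoly ξ (b y) ^ r) :=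
    fun ξ r => ((hmeas ξ).pow_const r).aestronglyMeasurable
  -- the real part of `kelvinPoly` exceeds `2 / 9` wherever `a` does not vanish
  have hpow : ∀ ξ ∈ Metric.ball (0 : CSpace n) (3 * M)⁻¹, ∀ y, a y ≠ 0 → ∀ r : ℝ, r ≤ 0 →
      ‖kelvinPoly ξ (b y) ^ (r : ℂ)‖ ≤ (2 / 9 : ℝ) ^ r := by
    intro ξ hξ y hy r hr
    have h1 := re_kelvinPoly_gt (hball ξ hξ y hy)
    rw [Complex.norm_cpow_real]
    exact Real.rpow_le_rpow_of_nonpos (by norm_num)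
      (h1.le.trans ((le_abs_self _).trans (Complex.abs_re_le_norm _))) hr
  have hpow' : ∀ ξ ∈ Metric.ball (0 : CSpace n) (3 * M)⁻¹, ∀ y, a y ≠ 0 →
      ‖kelvinPoly ξ (b y) ^ (s : ℂ)‖ ≤ 2 * (2 / 9 : ℝ) ^ (s - 1) := by
    intro ξ hξ y hy
    have h1 := re_kelvinPoly_gt (hball ξ hξ y hy)
    have h0 : kelvinPoly ξ (b y) ≠ 0 := fun h => by rw [h] at h1; norm_num at h1
    have h2 : kelvinPoly ξ (b y) ^ (s : ℂ) =
        kelvinPoly ξ (b y) ^ ((s - 1 : ℝ) : ℂ) * kelvinPoly ξ (b y) := by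
      nth_rw 3 [← Complex.cpow_one (kelvinPoly ξ (b y))]
      rw [← Complex.cpow_add _ _ h0]
      congr 1
      push_cast
      ring
    have h3 : ‖kelvinPoly ξ (b y)‖ ≤ 2 := by
      have h4 := norm_kelvinPoly_sub_one_le ξ (b y)
      have h5 := norm_add_le (kelvinPoly ξ (b y) - 1) 1
      have h6 := hball ξ hξ y hy
      have h7 : 0 ≤ ‖ξ‖ * ‖b y‖ := by positivity
      rw [sub_add_cancel, norm_one] at h5
      nlinarith
    rw [h2, norm_mul, mul_comm]
    exact mul_le_mul h3 (hpow ξ hξ y hy (s - 1) (by linarith)) (norm_nonneg _) (by norm_num)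
  refine (hasFDerivAt_integral_of_dominated_of_fderiv_le (F' := F')
    (bound := fun y => (|s| * (2 / 9 : ℝ) ^ (s - 1) * (3 * M)) * ‖a y‖)
    (Metric.isOpen_ball.mem_nhds hξ₀) ?_ ?_ ?_ ?_ (ha.norm.const_mul _) ?_).differentiableAt
  · exact Eventually.of_forall fun ξ => ha.aestronglyMeasurable.mul (hmeas1 ξ _)
  · refine (ha.norm.const_mul (2 * (2 / 9 : ℝ) ^ (s - 1))).mono'
      (ha.aestronglyMeasurable.mul (hmeas1 ξ₀ _)) (Eventually.of_forall fun y => ?_)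
    by_cases hy : a y = 0
    · simp [hy]
    · rw [norm_mul, mul_comm]
      exact mul_le_mul_of_nonneg_right (hpow' ξ₀ hξ₀ y hy) (norm_nonneg _)
  · refine ha.aestronglyMeasurable.smul (((hmeas1 ξ₀ _).const_mul _).smul ?_)
    have h1 : Continuous fun w : RSpace n =>
        (-2 : ℂ) • bformL n (toC w) + (2 * (‖w‖ ^ 2 : ℝ) : ℂ) • bformL n ξ₀ := by
      have : Continuous fun w : RSpace n => bformL n (toC w) :=
        (bformL n).continuous.comp continuous_toC
      fun_prop
    exact h1.comp_aestronglyMeasurable hb.aestronglyMeasurable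
  · refine Eventually.of_forall fun y ξ hξ => ?_
    by_cases hy : a y = 0
    · simp [hF'0 ξ y hy, hy]
    · have h1 := hpow ξ hξ y hy (s - 1) (by linarith)
      push_cast at h1
      have h2 : ‖(-2 : ℂ) • bformL n (toC (b y)) + (2 * (‖b y‖ ^ 2 : ℝ) : ℂ) • bformL n ξ‖ ≤
          3 * M := by
        refine (norm_add_le _ _).trans ?_
        rw [norm_smul, norm_smul, norm_mul, Complex.norm_real, norm_neg, Complex.norm_ofNat,
          Real.norm_of_nonneg (by positivity)]
        have h3 := norm_bformL_apply_le (toC (b y))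
        have h4 := norm_bformL_apply_le ξ
        rw [norm_toC] at h3
        have h5 := hab y hy
        have h6 := hball ξ hξ y hy
        have h7 : 2 * ‖b y‖ ^ 2 * ‖bformL n ξ‖ ≤ 2 * ‖b y‖ ^ 2 * ‖ξ‖ := by gcongr
        have h8 : ‖b y‖ * (3 * (‖ξ‖ * ‖b y‖)) ≤ ‖b y‖ * 1 := by gcongr
        nlinarith
      simp only [hF']
      rw [norm_smul, norm_smul, norm_mul, Complex.norm_real, Real.norm_eq_abs, mul_comm]
      gcongr
  · refine Eventually.of_forall fun y ξ hξ => ?_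
    by_cases hy : a y = 0
    · simpa [hF'0 ξ y hy, hy] using hasFDerivAt_const (0 : ℂ) ξ
    · have h1 := re_kelvinPoly_gt (hball ξ hξ y hy)
      have h2 := (((Complex.hasStrictDerivAt_cpow_const (c := (s : ℂ)) (x := kelvinPoly ξ (b y))
        (Or.inl (by linarith))).hasDerivAt.comp_hasFDerivAt ξ
        (hasFDerivAt_kelvinPoly ξ (b y))).const_mul (a y))
      exact h2

lemma kelvinPoly_toC (x y : RSpace n) :
    kelvinPoly (toC x) y = ((1 - 2 * inner ℝ x y + ‖x‖ ^ 2 * ‖y‖ ^ 2 : ℝ) : ℂ) := by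
  rw [kelvinPoly, bform_toC, bform_toC_self]
  push_cast
  ring

lemma kelvinPoly_toC_nonneg (x y : RSpace n) :
    0 ≤ 1 - 2 * inner ℝ x y + ‖x‖ ^ 2 * ‖y‖ ^ 2 := by
  have := real_inner_le_norm x y
  nlinarith [sq_nonneg (1 - ‖x‖ * ‖y‖)]

/-- A power of the distance to `x` in a form that is holomorphic in `x` for small `x`. -/
lemma distPow_eq_inner {s : ℝ} {x y : RSpace n} (hy : y ≠ 0) :
    (distPow s 0 x y : ℂ) =
      (((‖y‖ ^ 2) ^ s : ℝ) : ℂ) * kelvinPoly (toC x) ((‖y‖ ^ 2)⁻¹ • y) ^ (s : ℂ) := by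
  have h : ‖y‖ ≠ 0 := norm_ne_zero_iff.2 hy
  rw [kelvinPoly_toC, ← Complex.ofReal_cpow (kelvinPoly_toC_nonneg _ _), ← Complex.ofReal_mul,
    ← Real.mul_rpow (by positivity) (kelvinPoly_toC_nonneg _ _), distPow, add_zero]
  congr 2
  rw [norm_sub_sq_real, real_inner_comm, norm_smul, inner_smul_right,
    Real.norm_of_nonneg (by positivity)]
  field_simp

/-- A power of the distance to `x` in a form that is holomorphic in `x / ‖x‖²` for large `x`. -/
lemma distPow_eq_outer {s : ℝ} {x y : RSpace n} (hx : x ≠ 0) :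
    (distPow s 0 x y : ℂ) =
      (((‖x‖ ^ 2) ^ s : ℝ) : ℂ) * kelvinPoly (toC ((‖x‖ ^ 2)⁻¹ • x)) y ^ (s : ℂ) := by
  have h : ‖x‖ ≠ 0 := norm_ne_zero_iff.2 hx
  rw [kelvinPoly_toC, ← Complex.ofReal_cpow (kelvinPoly_toC_nonneg _ _), ← Complex.ofReal_mul,
    ← Real.mul_rpow (by positivity) (kelvinPoly_toC_nonneg _ _), distPow, add_zero]
  congr 2
  rw [norm_sub_sq_real, real_inner_comm, norm_smul, real_inner_smul_left,
    Real.norm_of_nonneg (by positivity)]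
  field_simp
  ring

/-! ### Cutting off a harmonic function -/

/-- A smooth function that is `1` on the ball of radius `R` and `0` off the ball of radius
`2 R`. -/
noncomputable def cutoff (R : ℝ) (y : RSpace n) : ℝ :=
  (⟨1, 2, one_pos, one_lt_two⟩ : ContDiffBump (0 : RSpace n)) (R⁻¹ • y)

lemma contDiff_cutoff (R : ℝ) : ContDiff ℝ 2 (cutoff (n := n) R) :=
  (ContDiffBump.contDiff _).comp (contDiff_const_smul _)

lemma cutoff_eq_one {R : ℝ} (hR : 0 < R) {y : RSpace n} (hy : ‖y‖ ≤ R) : cutoff R y = 1 := by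
  refine ContDiffBump.one_of_mem_closedBall _ ?_
  rw [mem_closedBall_zero_iff, norm_smul, Real.norm_of_nonneg (by positivity)]
  exact (inv_mul_le_iff₀ hR).2 (by linarith)

lemma cutoff_eq_zero {R : ℝ} (hR : 0 < R) {y : RSpace n} (hy : 2 * R ≤ ‖y‖) : cutoff R y = 0 := by
  refine ContDiffBump.zero_of_le_dist _ ?_
  rw [dist_zero_right, norm_smul, Real.norm_of_nonneg (by positivity)]
  exact (le_inv_mul_iff₀ hR).2 (by linarith)

open Classical in
/-- The Laplacian of the product of a function `u`, harmonic off the origin, with a cutoff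
function. It is supported in the shell `R ≤ ‖y‖ ≤ 2 R`, and the value at the origin is set
accordingly. -/
noncomputable def shellDensity (u : RSpace n → ℂ) (R : ℝ) (y : RSpace n) : ℂ :=
  if y = 0 then 0 else Δ (fun w => cutoff R w • u w) y

section Shell

variable {u : RSpace n → ℂ} (hu : HarmonicOnNhd u ({0}ᶜ : Set (RSpace n))) {R : ℝ} (hR : 0 < R)
include hR

lemma shellDensity_of_large {y : RSpace n} (hy : 2 * R < ‖y‖) : shellDensity u R y = 0 := by
  rw [shellDensity]
  split_ifs with h
  · rfl
  · have h1 : (fun w => cutoff R w • u w) =ᶠ[𝓝 y] fun _ => 0 := by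
      filter_upwards [continuous_norm.continuousAt.eventually_const_lt hy] with w hw
      rw [cutoff_eq_zero hR hw.le, zero_smul]
    rw [(laplacian_congr_nhds h1).self_of_nhds, laplacian_const]
    rfl

include hu

lemma shellDensity_of_small {y : RSpace n} (hy : ‖y‖ < R) : shellDensity u R y = 0 := by
  rw [shellDensity]
  split_ifs with h
  · rfl
  · have h1 : (fun w => cutoff R w • u w) =ᶠ[𝓝 y] u := by
      filter_upwards [continuous_norm.continuousAt.eventually_lt_const hy] with w hw
      rw [cutoff_eq_one hR hw.le, one_smul]
    rw [(laplacian_congr_nhds h1).self_of_nhds, (hu y h).2.self_of_nhds]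
    rfl

lemma norm_mem_of_shellDensity_ne_zero {y : RSpace n} (hy : shellDensity u R y ≠ 0) :
    R ≤ ‖y‖ ∧ ‖y‖ ≤ 2 * R := by
  constructor
  · by_contra! h
    exact hy (shellDensity_of_small hu hR h)
  · by_contra! h
    exact hy (shellDensity_of_large hR h)

omit hR in
lemma contDiffAt_cutoff_smul (R : ℝ) {y : RSpace n} (hy : y ≠ 0) :
    ContDiffAt ℝ 2 (fun w => cutoff R w • u w) y :=
  (contDiff_cutoff R).contDiffAt.smul (hu y hy).1

lemma integrable_shellDensity : Integrable (shellDensity u R) := by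
  have hcont : Continuous (shellDensity u R) := by
    refine continuous_iff_continuousAt.2 fun y => ?_
    by_cases hy : y = 0
    · have : shellDensity u R =ᶠ[𝓝 y] fun _ => 0 := by
        have h0 : ‖y‖ < R := by simpa [hy] using hR
        filter_upwards [continuous_norm.continuousAt.eventually_lt_const h0] with w hw
        exact shellDensity_of_small hu hR hw
      exact continuousAt_const.congr this.symm
    · have h1 : ContinuousAt (fun w => ∑ i, fderiv ℝ (fderiv ℝ (fun w => cutoff R w • u w)) w
          (stdOrthonormalBasis ℝ (RSpace n) i) (stdOrthonormalBasis ℝ (RSpace n) i)) y := by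
        have h2 : ContinuousAt (fderiv ℝ (fderiv ℝ (fun w => cutoff R w • u w))) y :=
          (((contDiffAt_cutoff_smul hu R hy).fderiv_right (m := 1) (by norm_num)).fderiv_right
            (m := 0) (by norm_num)).continuousAt
        fun_prop
      refine h1.congr ?_
      filter_upwards [isOpen_compl_singleton.mem_nhds hy] with w hw
      rw [shellDensity, if_neg (mem_compl_singleton_iff.1 hw), laplacian_eq_sum_fderiv]
  refine hcont.integrable_of_hasCompactSupport ?_
  refine HasCompactSupport.of_support_subset_isCompact (isCompact_closedBall 0 (2 * R)) ?_
  intro y hy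
  simpa using (norm_mem_of_shellDensity_ne_zero hu hR hy).2

end Shell

lemma integrable_distPow_smul {s : ℝ} (hs : s ≤ 0) {ψ : RSpace n → ℂ} (hψ : Integrable ψ)
    {x : RSpace n} (hx : ∀ᶠ y in 𝓝 x, ψ y = 0) : Integrable fun y => distPow s 0 x y • ψ y := by
  obtain ⟨r, hr, hrψ⟩ := Metric.eventually_nhds_iff.1 hx
  have hm : Measurable fun y : RSpace n => distPow s 0 x y := by
    unfold distPow
    fun_prop
  refine (hψ.norm.const_mul ((r ^ 2) ^ s)).mono'
    (hm.aestronglyMeasurable.smul hψ.aestronglyMeasurable) (Eventually.of_forall fun y => ?_)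
  by_cases hy : dist y x < r
  · simp [hrψ hy]
  · rw [norm_smul]
    refine mul_le_mul_of_nonneg_right ?_ (norm_nonneg _)
    rw [not_lt, dist_eq_norm] at hy
    rw [distPow, add_zero, Real.norm_of_nonneg (by positivity)]
    exact Real.rpow_le_rpow_of_nonpos (by positivity) (pow_le_pow_left₀ hr.le hy 2) hs

/-- A function that is harmonic off the origin is, up to a constant factor, the difference of the
Newtonian potentials of densities in an outer and an inner shell. -/
theorem exists_integral_shellDensity_sub (hn : 3 ≤ n) :
    ∃ c : ℝ, c ≠ 0 ∧ ∀ u : RSpace n → ℂ, HarmonicOnNhd u ({0}ᶜ : Set (RSpace n)) →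
      ∀ (r R : ℝ) (x : RSpace n), 0 < r → 2 * r < ‖x‖ → ‖x‖ < R →
        (∫ y, distPow (-((n - 2 : ℝ) / 2)) 0 x y • shellDensity u R y) -
          ∫ y, distPow (-((n - 2 : ℝ) / 2)) 0 x y • shellDensity u r y = c • u x := by
  have hn' : finrank ℝ (RSpace n) = n := finrank_euclideanSpace_fin
  obtain ⟨c, hc0, hc⟩ := exists_integral_distPow_smul_laplacian (E := RSpace n) (by rwa [hn'])
  rw [hn'] at hc
  refine ⟨c, hc0, fun u hu r R x hr hrx hxR => ?_⟩
  have hs : -((n - 2 : ℝ) / 2) ≤ 0 := by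
    have : (3 : ℝ) ≤ n := by exact_mod_cast hn
    linarith
  have hR : 0 < R := by linarith [norm_nonneg x]
  set v : RSpace n → ℂ := fun w => cutoff R w • u w - cutoff r w • u w with hv
  have hv0 : ∀ y : RSpace n, ‖y‖ < r → v =ᶠ[𝓝 y] fun _ => 0 := fun y hy => by
    filter_upwards [continuous_norm.continuousAt.eventually_lt_const hy] with w hw
    simp only [hv]
    rw [cutoff_eq_one hr hw.le, cutoff_eq_one hR (by linarith), sub_self]
  have hv2 : ContDiff ℝ 2 v := by
    refine contDiff_iff_contDiffAt.2 fun y => ?_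
    by_cases hy : y = 0
    · exact contDiffAt_const.congr_of_eventuallyEq (hv0 y (by simpa [hy] using hr))
    · exact (contDiffAt_cutoff_smul hu R hy).sub (contDiffAt_cutoff_smul hu r hy)
  have hvc : HasCompactSupport v := by
    refine HasCompactSupport.of_support_subset_isCompact (isCompact_closedBall 0 (2 * R)) ?_
    intro y hy
    rw [mem_closedBall_zero_iff]
    by_contra! h
    refine hy ?_
    simp only [hv]
    rw [cutoff_eq_zero hR h.le, cutoff_eq_zero hr (by linarith), sub_self]
  have hlap : ∀ y, Δ v y = shellDensity u R y - shellDensity u r y := by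
    intro y
    by_cases hy : y = 0
    · rw [(laplacian_congr_nhds (hv0 y (by simpa [hy] using hr))).self_of_nhds, laplacian_const]
      simp [shellDensity, hy]
    · rw [shellDensity, shellDensity, if_neg hy, if_neg hy]
      exact (contDiffAt_cutoff_smul hu R hy).laplacian_sub (contDiffAt_cutoff_smul hu r hy)
  have hxR' : ∀ᶠ y in 𝓝 x, shellDensity u R y = 0 := by
    filter_upwards [continuous_norm.continuousAt.eventually_lt_const hxR] with y hy
    exact shellDensity_of_small hu hR hy
  have hxr' : ∀ᶠ y in 𝓝 x, shellDensity u r y = 0 := by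
    filter_upwards [continuous_norm.continuousAt.eventually_const_lt hrx] with y hy
    exact shellDensity_of_large hr hy
  have hvx : v x = u x := by
    simp only [hv]
    rw [cutoff_eq_one hR hxR.le, cutoff_eq_zero hr hrx.le, one_smul, zero_smul, sub_zero]
  rw [← hvx, ← hc v x hv2 hvc ?_, ← integral_sub
    (integrable_distPow_smul hs (integrable_shellDensity hu hR) hxR')
    (integrable_distPow_smul hs (integrable_shellDensity hu hr) hxr')]
  · simp only [hlap, smul_sub]
  · filter_upwards [hxR', hxr'] with y h1 h2
    rw [hlap, h1, h2, sub_self]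
    rfl

end HarmonicHull

namespace HarmonicHull

open Filter Topology MeasureTheory InnerProductSpace

variable {n : ℕ}

/-! ### The Laurent decomposition of a harmonic function -/

/-- A family of holomorphic functions on the balls about the origin that are consistent at the
real points comes from an entire function. -/
lemma exists_differentiable_eqOn_ball [NeZero n] {f : ℝ → CSpace n → ℂ}
    (hd : ∀ ρ, 0 < ρ → DifferentiableOn ℂ (f ρ) (Metric.ball 0 ρ))
    (hc : ∀ ρ ρ', 0 < ρ → ρ ≤ ρ' → ∀ x : RSpace n, x ≠ 0 → ‖x‖ < ρ →
      f ρ (toC x) = f ρ' (toC x)) :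
    ∃ F : CSpace n → ℂ, Differentiable ℂ F ∧
      ∀ ρ, 0 < ρ → ∀ z ∈ Metric.ball (0 : CSpace n) ρ, F z = f ρ z := by
  have hmono : ∀ ρ ρ', 0 < ρ → ρ ≤ ρ' → EqOn (f ρ) (f ρ') (Metric.ball 0 ρ) := by
    intro ρ ρ' hρ hρρ'
    have hx0 : ‖(ρ / 2) • e₁ n‖ = ρ / 2 := by
      rw [norm_smul, Real.norm_of_nonneg (by positivity)]
      simp [e₁]
    refine eqOn_of_eventually_real (x₀ := (ρ / 2) • e₁ n) Metric.isOpen_ball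
      (convex_ball _ _).isPreconnected (hd ρ hρ)
      ((hd ρ' (hρ.trans_le hρρ')).mono (Metric.ball_subset_ball hρρ')) ?_ ?_
    · rw [mem_ball_zero_iff, norm_toC, hx0]
      linarith
    · have h1 : ‖(ρ / 2) • e₁ n‖ < ρ := by rw [hx0]; linarith
      have h2 : 0 < ‖(ρ / 2) • e₁ n‖ := by rw [hx0]; linarith
      filter_upwards [continuous_norm.continuousAt.eventually_lt_const h1,
        continuous_norm.continuousAt.eventually_const_lt h2] with x hx1 hx2
      exact hc ρ ρ' hρ hρρ' x (norm_pos_iff.1 hx2) hx1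
  have heq : ∀ ρ, 0 < ρ → ∀ z ∈ Metric.ball (0 : CSpace n) ρ, f (‖z‖ + 1) z = f ρ z := by
    intro ρ hρ z hz
    have hz' : z ∈ Metric.ball (0 : CSpace n) (‖z‖ + 1) := by simp
    rcases le_total ρ (‖z‖ + 1) with h | h
    · exact (hmono _ _ hρ h hz).symm
    · exact hmono _ _ (by positivity) h hz'
  refine ⟨fun z => f (‖z‖ + 1) z, fun z => ?_, heq⟩
  have hz : z ∈ Metric.ball (0 : CSpace n) (‖z‖ + 1) := by simp
  have hnhds := Metric.isOpen_ball.mem_nhds hz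
  refine ((hd _ (by positivity)).differentiableAt hnhds).congr_of_eventuallyEq ?_
  filter_upwards [hnhds] with w hw
  exact heq _ (by positivity) w hw

/-- A harmonic function on the complement of the origin is the sum of the restriction of an entire
function and the Kelvin transform of the restriction of an entire function. -/
theorem exists_laurent_decomposition (hn : 3 ≤ n) {u : RSpace n → ℂ}
    (hu : HarmonicOnNhd u ({0}ᶜ : Set (RSpace n))) :
    ∃ F G : CSpace n → ℂ, Differentiable ℂ F ∧ Differentiable ℂ G ∧ ∀ x : RSpace n, x ≠ 0 →
      u x = F (toC x) + newtonian n x * G (toC ((‖x‖ ^ 2)⁻¹ • x)) := by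
  have : NeZero n := ⟨by omega⟩
  obtain ⟨c, hc0, hc⟩ := exists_integral_shellDensity_sub hn
  replace hc := hc u hu
  set s : ℝ := -((n - 2 : ℝ) / 2) with hs
  have hs0 : s ≤ 0 := by
    have : (3 : ℝ) ≤ n := by exact_mod_cast hn
    rw [hs]
    linarith
  set P : ℝ → RSpace n → ℂ := fun R x => ∫ y, distPow s 0 x y • shellDensity u R y with hP
  have hPsmall : ∀ R R' x, x ≠ 0 → ‖x‖ < R → ‖x‖ < R' → P R x = P R' x := by
    intro R R' x hx hxR hxR'
    have hx' : 0 < ‖x‖ := norm_pos_iff.2 hx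
    have h1 := hc (‖x‖ / 4) R x (by positivity) (by linarith) hxR
    have h2 := hc (‖x‖ / 4) R' x (by positivity) (by linarith) hxR'
    exact sub_left_injective (h1.trans h2.symm)
  have hPlarge : ∀ r r' x, 0 < r → 0 < r' → 2 * r < ‖x‖ → 2 * r' < ‖x‖ → P r x = P r' x := by
    intro r r' x hr hr' hrx hrx'
    have h1 := hc r (‖x‖ + 1) x hr hrx (by linarith)
    have h2 := hc r' (‖x‖ + 1) x hr' hrx' (by linarith)
    exact sub_right_injective (h1.trans h2.symm)
  -- the potential of the outer shell of radius `3 ρ` is holomorphic in the ball of radius `ρ`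
  set f : ℝ → CSpace n → ℂ := fun ρ z => ∫ y, (shellDensity u (3 * ρ) y *
    (((‖y‖ ^ 2) ^ s : ℝ) : ℂ)) * kelvinPoly z ((‖y‖ ^ 2)⁻¹ • y) ^ (s : ℂ) with hf
  have hfP : ∀ ρ, 0 < ρ → ∀ x : RSpace n, f ρ (toC x) = P (3 * ρ) x := by
    intro ρ hρ x
    refine integral_congr_ae (Eventually.of_forall fun y => ?_)
    simp only
    by_cases hy : y = 0
    · simp [shellDensity, hy]
    · rw [Complex.real_smul, distPow_eq_inner hy]
      ring
  have hfd : ∀ ρ, 0 < ρ → DifferentiableOn ℂ (f ρ) (Metric.ball 0 ρ) := by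
    intro ρ hρ
    have h3 : 0 < 3 * ρ := by positivity
    have hi := integrable_shellDensity hu h3
    have hm : Measurable fun y : RSpace n => (((‖y‖ ^ 2) ^ s : ℝ) : ℂ) := by fun_prop
    have hint : Integrable fun y => shellDensity u (3 * ρ) y * (((‖y‖ ^ 2) ^ s : ℝ) : ℂ) := by
      refine (hi.norm.const_mul (((3 * ρ) ^ 2) ^ s)).mono'
        (hi.aestronglyMeasurable.mul hm.aestronglyMeasurable) (Eventually.of_forall fun y => ?_)
      by_cases hy : shellDensity u (3 * ρ) y = 0
      · simp [hy]
      · have h1 := (norm_mem_of_shellDensity_ne_zero hu h3 hy).1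
        rw [norm_mul, mul_comm, Complex.norm_real, Real.norm_of_nonneg (by positivity)]
        refine mul_le_mul_of_nonneg_right ?_ (norm_nonneg _)
        exact Real.rpow_le_rpow_of_nonpos (by positivity) (pow_le_pow_left₀ h3.le h1 2) hs0
    have hb : Measurable fun y : RSpace n => (‖y‖ ^ 2)⁻¹ • y := by fun_prop
    have := differentiableOn_integral_kelvinPoly (s := s) (by linarith) hint hb
      (M := (3 * ρ)⁻¹) (by positivity) ?_
    · convert! this using 2
      field_simp
    · intro y hy
      have h1 := (norm_mem_of_shellDensity_ne_zero hu h3 (left_ne_zero_of_mul hy)).1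
      have h2 : 0 < ‖y‖ := h3.trans_le h1
      rw [norm_smul, Real.norm_of_nonneg (by positivity)]
      have h4 : (‖y‖ ^ 2)⁻¹ * ‖y‖ = ‖y‖⁻¹ := by field_simp
      rw [h4]
      exact inv_anti₀ h3 h1
  -- the potential of the inner shell of radius `1 / (6 ρ)` is the Kelvin transform of a function
  -- that is holomorphic in the ball of radius `ρ`
  set g : ℝ → CSpace n → ℂ := fun ρ ξ => ∫ y, shellDensity u (6 * ρ)⁻¹ y *
    kelvinPoly ξ y ^ (s : ℂ) with hg
  have hgP : ∀ ρ, 0 < ρ → ∀ x : RSpace n, x ≠ 0 →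
      P (6 * ρ)⁻¹ x = newtonian n x * g ρ (toC ((‖x‖ ^ 2)⁻¹ • x)) := by
    intro ρ hρ x hx
    rw [hP, hg, newtonian, inv_pow_eq_rpow (by omega) (norm_nonneg x), ← integral_const_mul]
    refine integral_congr_ae (Eventually.of_forall fun y => ?_)
    simp only
    rw [Complex.real_smul, distPow_eq_outer hx]
    ring
  have hgd : ∀ ρ, 0 < ρ → DifferentiableOn ℂ (g ρ) (Metric.ball 0 ρ) := by
    intro ρ hρ
    have h6 : 0 < (6 * ρ)⁻¹ := by positivity
    have := differentiableOn_integral_kelvinPoly (s := s) (by linarith)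
      (integrable_shellDensity hu h6) measurable_id (M := 2 * (6 * ρ)⁻¹) (by positivity)
      (fun y hy => (norm_mem_of_shellDensity_ne_zero hu h6 hy).2)
    convert! this using 2
    field_simp
    norm_num
  have hinv : ∀ x : RSpace n, x ≠ 0 → ‖(‖x‖ ^ 2)⁻¹ • x‖ = ‖x‖⁻¹ := by
    intro x hx
    have : ‖x‖ ≠ 0 := norm_ne_zero_iff.2 hx
    rw [norm_smul, Real.norm_of_nonneg (by positivity)]
    field_simp
  obtain ⟨F, hF, hFf⟩ := exists_differentiable_eqOn_ball hfd (by
    intro ρ ρ' hρ hρρ' x hx hxρ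
    rw [hfP ρ hρ, hfP ρ' (hρ.trans_le hρρ')]
    exact hPsmall _ _ x hx (by linarith) (by linarith))
  obtain ⟨G, hG, hGg⟩ := exists_differentiable_eqOn_ball hgd (by
    intro ρ ρ' hρ hρρ' ξ hξ hξρ
    have hξ' : 0 < ‖ξ‖ := norm_pos_iff.2 hξ
    have hρ' := hρ.trans_le hρρ'
    set x : RSpace n := (‖ξ‖ ^ 2)⁻¹ • ξ with hx
    have hx0 : x ≠ 0 := smul_ne_zero (by positivity) hξ
    have hxξ : (‖x‖ ^ 2)⁻¹ • x = ξ := by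
      rw [hinv ξ hξ, hx, smul_smul]
      convert one_smul ℝ ξ
      field_simp
    have hlarge : ∀ ρ, 0 < ρ → ‖ξ‖ < ρ → 2 * (6 * ρ)⁻¹ < ‖x‖ := by
      intro ρ hρ hξρ
      rw [hinv ξ hξ]
      refine lt_of_le_of_lt ?_ (inv_strictAnti₀ hξ' hξρ)
      rw [mul_inv]
      have : 0 < ρ⁻¹ := by positivity
      linarith
    have hN : newtonian n x ≠ 0 := by
      have := newtonian_sq_mul x hx0
      intro h0
      rw [h0] at this
      norm_num at this
    have h1 := hPlarge (6 * ρ)⁻¹ (6 * ρ')⁻¹ x (by positivity) (by positivity)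
      (hlarge ρ hρ hξρ) (hlarge ρ' hρ' (by linarith))
    rw [hgP ρ hρ x hx0, hgP ρ' hρ' x hx0, hxξ] at h1
    exact mul_left_cancel₀ hN h1)
  refine ⟨fun z => (c : ℂ)⁻¹ * F z, fun z => -((c : ℂ)⁻¹ * G z), hF.const_mul _,
    (hG.const_mul _).neg, fun x hx => ?_⟩
  have hx' : 0 < ‖x‖ := norm_pos_iff.2 hx
  have h1 : F (toC x) = P (3 * (‖x‖ + 1)) x := by
    rw [hFf (‖x‖ + 1) (by positivity) _ (by simp), hfP _ (by positivity)]
  have h2 : newtonian n x * G (toC ((‖x‖ ^ 2)⁻¹ • x)) = P (6 * (2 * ‖x‖⁻¹))⁻¹ x := by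
    rw [hgP _ (by positivity) x hx, hGg (2 * ‖x‖⁻¹) (by positivity)]
    rw [mem_ball_zero_iff, norm_toC, hinv x hx]
    have : 0 < ‖x‖⁻¹ := by positivity
    linarith
  have h3 := hc (6 * (2 * ‖x‖⁻¹))⁻¹ (3 * (‖x‖ + 1)) x (by positivity)
    (by
      have : (6 * (2 * ‖x‖⁻¹))⁻¹ = ‖x‖ / 12 := by field_simp; norm_num
      rw [this]
      linarith) (by linarith)
  have hc' : (c : ℂ) ≠ 0 := by exact_mod_cast hc0
  beta_reduce
  rw [mul_neg, mul_left_comm (newtonian n x), h1, h2, ← sub_eq_add_neg, ← mul_sub]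
  simp only [hP]
  rw [h3, Complex.real_smul, inv_mul_cancel_left₀ hc']

/-- If `z²` has a holomorphic square root on `W` that is positive at the real points, then the
Laurent decomposition extends every harmonic function to `W`. -/
theorem extendsTo_of_sqrt (hn : 3 ≤ n) {W : Set (CSpace n)} {σ : CSpace n → ℂ}
    (hσ : DifferentiableOn ℂ σ W) (hσ2 : ∀ z ∈ W, σ z ^ 2 = bform z z)
    (hW : ∀ z ∈ W, bform z z ≠ 0) (hσr : ∀ x : RSpace n, x ≠ 0 → toC x ∈ W → σ (toC x) = ‖x‖)
    {u : RSpace n → ℂ} (hu : HarmonicOnNhd u ({0}ᶜ : Set (RSpace n))) :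
    ExtendsTo ({0}ᶜ : Set (RSpace n)) u W := by
  obtain ⟨F, G, hF, hG, hFG⟩ := exists_laurent_decomposition hn hu
  have hσ0 : ∀ z ∈ W, σ z ^ (n - 2) ≠ 0 := fun z hz => by
    refine pow_ne_zero _ fun h0 => hW z hz ?_
    rw [← hσ2 z hz, h0]
    norm_num
  refine ⟨fun z => F z + (σ z ^ (n - 2))⁻¹ * G ((bform z z)⁻¹ • z), ?_, ?_⟩
  · refine hF.differentiableOn.add (((hσ.pow (n - 2)).fun_inv hσ0).mul ?_)
    refine hG.comp_differentiableOn ?_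
    exact (differentiable_bform_self.differentiableOn.fun_inv hW).smul differentiableOn_id
  · intro x hx hxW
    simp only
    rw [hFG x hx, hσr x hx hxW, bform_toC_self, newtonian, ← Complex.ofReal_inv, ← toC_smul]
    push_cast
    rfl

end HarmonicHull

namespace HarmonicHull

open Filter Topology

variable {n : ℕ} [NeZero n]

/-! ### The conformal denominator -/

/-- The bounds on the terms of the conformal denominator that the condition `9 ε² ‖z‖² < 1`
gives. -/
lemma norm_lt_of_ball {ε : ℝ} {z : CSpace n} (h : 9 * ε ^ 2 * ‖z‖ ^ 2 < 1) :
    ‖(ε : ℂ) * z 0‖ < 1 / 3 ∧ ‖(ε : ℂ) ^ 2 * bform z z‖ < 1 / 9 := by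
  have h1 : ‖z 0‖ ≤ ‖z‖ := PiLp.norm_apply_le z 0
  have h2 := norm_bform_le z z
  constructor
  · rw [norm_mul, Complex.norm_real, Real.norm_eq_abs]
    refine lt_of_pow_lt_pow_left₀ 2 (by norm_num) ?_
    have h3 : (|ε| * ‖z 0‖) ^ 2 ≤ ε ^ 2 * ‖z‖ ^ 2 := by
      rw [mul_pow, sq_abs]
      gcongr
    linarith
  · rw [norm_mul, norm_pow, Complex.norm_real, Real.norm_eq_abs, sq_abs]
    have h3 := mul_le_mul_of_nonneg_left h2 (sq_nonneg ε)
    nlinarith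

lemma confDenom_eq (ε : ℝ) (z : CSpace n) :
    confDenom ε z = 1 + 2 * ((ε : ℂ) * z 0) + (ε : ℂ) ^ 2 * bform z z := by
  rw [confDenom]
  ring

lemma re_confDenom_pos {ε : ℝ} {z : CSpace n} (h : 9 * ε ^ 2 * ‖z‖ ^ 2 < 1) :
    0 < (confDenom ε z).re := by
  obtain ⟨h1, h2⟩ := norm_lt_of_ball h
  have h3 := (abs_le.1 (Complex.abs_re_le_norm ((ε : ℂ) * z 0))).1
  have h4 := (abs_le.1 (Complex.abs_re_le_norm ((ε : ℂ) ^ 2 * bform z z))).1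
  rw [confDenom_eq, Complex.add_re, Complex.add_re, Complex.one_re]
  have h5 : (2 * ((ε : ℂ) * z 0)).re = 2 * ((ε : ℂ) * z 0).re := by
    rw [← Complex.re_ofReal_mul]
    norm_num
  rw [h5]
  linarith

lemma confDenom_ne_zero {ε : ℝ} {z : CSpace n} (h : 9 * ε ^ 2 * ‖z‖ ^ 2 < 1) :
    confDenom ε z ≠ 0 := fun h0 => by
  have := re_confDenom_pos h
  rw [h0] at this
  exact lt_irrefl _ this

@[simp] lemma confDenom_zero (z : CSpace n) : confDenom 0 z = 1 := by simp [confDenom]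

lemma differentiable_confDenom (ε : ℝ) : Differentiable ℂ (confDenom (n := n) ε) := by
  unfold confDenom
  fun_prop

lemma confDenom_toC (ε : ℝ) (x : RSpace n) :
    confDenom ε (toC x) = ((1 + 2 * ε * x 0 + ε ^ 2 * ‖x‖ ^ 2 : ℝ) : ℂ) := by
  rw [confDenom, bform_toC_self, toC_apply]
  push_cast
  ring

lemma bform_ne_zero_of_mem_curvedHull {ε : ℝ} {z : CSpace n} (hz : z ∈ curvedHull n ε) :
    bform z z ≠ 0 := fun h0 => by
  have := hz.2
  rw [h0, zero_div] at this
  exact Complex.slitPlane_ne_zero this rfl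

lemma div_confDenom_mem_slitPlane {ε : ℝ} {z : CSpace n} (h : 9 * ε ^ 2 * ‖z‖ ^ 2 < 1)
    (hz : 0 < (bform z z).re) : bform z z / confDenom ε z ∈ Complex.slitPlane := by
  by_contra hcon
  rw [Complex.mem_slitPlane_iff, not_or, not_lt, ne_eq, not_not] at hcon
  have h1 : bform z z = ((bform z z / confDenom ε z).re : ℂ) * confDenom ε z := by
    have h2 : ((bform z z / confDenom ε z).re : ℂ) = bform z z / confDenom ε z :=
      Complex.ext (by simp) (by simp [hcon.2])
    rw [h2, div_mul_cancel₀ _ (confDenom_ne_zero h)]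
  have h3 := congrArg Complex.re h1
  rw [Complex.re_ofReal_mul] at h3
  have h4 := mul_nonneg (neg_nonneg.2 hcon.1) (re_confDenom_pos h).le
  linarith

lemma toC_mem_curvedHull {ε : ℝ} {x : RSpace n} (hx : x ≠ 0) (h : 9 * ε ^ 2 * ‖x‖ ^ 2 < 1) :
    toC x ∈ curvedHull n ε := by
  have h' : 9 * ε ^ 2 * ‖toC x‖ ^ 2 < 1 := by rwa [norm_toC]
  refine ⟨h', div_confDenom_mem_slitPlane h' ?_⟩
  rw [bform_toC_self, Complex.ofReal_re]
  have := norm_pos_iff.2 hx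
  positivity

/-! ### The square root of `z²` -/

/-- The branch of the square root of `z²` on `curvedHull n ε` that is positive at the real
points. -/
noncomputable def curvedSqrt (ε : ℝ) (z : CSpace n) : ℂ :=
  (bform z z / confDenom ε z) ^ (2⁻¹ : ℂ) * confDenom ε z ^ (2⁻¹ : ℂ)

lemma differentiableOn_curvedSqrt (ε : ℝ) :
    DifferentiableOn ℂ (curvedSqrt ε) (curvedHull n ε) := by
  have hD := (differentiable_confDenom (n := n) ε).differentiableOn (s := curvedHull n ε)
  refine DifferentiableOn.mul (DifferentiableOn.cpow_const ?_ fun z hz => hz.2)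
    (hD.cpow_const fun z hz => Or.inl (re_confDenom_pos hz.1))
  have hne : ∀ z ∈ curvedHull n ε, confDenom ε z ≠ 0 := fun z hz => confDenom_ne_zero hz.1
  simp only [div_eq_mul_inv]
  exact differentiable_bform_self.differentiableOn.mul (hD.fun_inv hne)

lemma curvedSqrt_sq {ε : ℝ} {z : CSpace n} (hz : z ∈ curvedHull n ε) :
    curvedSqrt ε z ^ 2 = bform z z := by
  have h : ∀ w : ℂ, (w ^ (2⁻¹ : ℂ)) ^ 2 = w := fun w => by
    exact_mod_cast Complex.cpow_nat_inv_pow w two_ne_zero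
  rw [curvedSqrt, mul_pow, h, h, div_mul_cancel₀ _ (confDenom_ne_zero hz.1)]

lemma curvedSqrt_toC {ε : ℝ} {x : RSpace n} (hx : toC x ∈ curvedHull n ε) :
    curvedSqrt ε (toC x) = ‖x‖ := by
  have h1 := re_confDenom_pos hx.1
  rw [curvedSqrt, confDenom_toC, bform_toC_self]
  rw [confDenom_toC, Complex.ofReal_re] at h1
  set d := 1 + 2 * ε * x 0 + ε ^ 2 * ‖x‖ ^ 2
  have h2 : (2⁻¹ : ℂ) = ((2⁻¹ : ℝ) : ℂ) := by push_cast; rfl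
  rw [h2, ← Complex.ofReal_div, ← Complex.ofReal_cpow (by positivity),
    ← Complex.ofReal_cpow h1.le, ← Complex.ofReal_mul, ← Real.mul_rpow (by positivity) h1.le,
    div_mul_cancel₀ _ h1.ne', ← one_div, ← Real.sqrt_eq_rpow, Real.sqrt_sq (norm_nonneg x)]

/-! ### Real points and the wedge around them -/

/-- A punctured ball, or the punctured space if `ε = 0`, is connected. -/
lemma isPreconnected_puncturedBall (hn : 2 ≤ n) (ε : ℝ) :
    IsPreconnected {x : RSpace n | x ≠ 0 ∧ 9 * ε ^ 2 * ‖x‖ ^ 2 < 1} := by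
  set r : ℝ := 3 * |ε| with hr
  have hr0 : 0 ≤ r := by positivity
  have hr2 : r ^ 2 = 9 * ε ^ 2 := by rw [hr, mul_pow, sq_abs]; norm_num
  have hconn : IsPreconnected ({0}ᶜ : Set (RSpace n)) := by
    refine (isConnected_compl_singleton_of_one_lt_rank ?_ 0).isPreconnected
    refine Module.one_lt_rank_of_one_lt_finrank ?_
    rw [finrank_euclideanSpace_fin]
    omega
  set φ : RSpace n → RSpace n := fun x => (1 + r * ‖x‖)⁻¹ • x with hφ
  have hpos : ∀ x : RSpace n, 0 < 1 + r * ‖x‖ := fun x => by positivity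
  have hφc : Continuous φ :=
    (Continuous.inv₀ (by fun_prop) fun x => (hpos x).ne').smul continuous_id
  have himage : {x : RSpace n | x ≠ 0 ∧ 9 * ε ^ 2 * ‖x‖ ^ 2 < 1} = φ '' {0}ᶜ := by
    refine subset_antisymm ?_ ?_
    · rintro y ⟨hy0, hy⟩
      have h1 : r * ‖y‖ < 1 := by
        refine lt_of_pow_lt_pow_left₀ 2 (by norm_num) ?_
        rw [mul_pow, hr2, one_pow]
        exact hy
      have h2 : 0 < 1 - r * ‖y‖ := by linarith
      refine ⟨(1 - r * ‖y‖)⁻¹ • y, smul_ne_zero (by positivity) hy0, ?_⟩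
      simp only [hφ]
      rw [norm_smul, Real.norm_of_nonneg (by positivity), smul_smul]
      convert one_smul ℝ y
      field_simp
      ring
    · rintro _ ⟨x, hx, rfl⟩
      refine ⟨smul_ne_zero (inv_ne_zero (hpos x).ne') hx, ?_⟩
      have h1 : 0 < (1 + r * ‖x‖)⁻¹ := inv_pos.2 (hpos x)
      simp only [hφ]
      rw [← hr2, norm_smul, Real.norm_of_nonneg h1.le, ← mul_pow]
      have h2 : r * ((1 + r * ‖x‖)⁻¹ * ‖x‖) < 1 := by
        rw [mul_left_comm, inv_mul_lt_iff₀ (hpos x)]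
        linarith
      exact pow_lt_one₀ (by positivity) h2 two_ne_zero
  rw [himage]
  exact hconn.image φ hφc.continuousOn

/-- The point `x + i t y` on the segment from the real part `x` to `z = x + i y`. -/
noncomputable def reSegment (z : CSpace n) (t : ℝ) : CSpace n :=
  toC (reC z) + Complex.I • toC (t • imC z)

omit [NeZero n]

lemma reSegment_one (z : CSpace n) : reSegment z 1 = z := by
  rw [reSegment, one_smul, toC_re_add_im]

lemma reSegment_zero (z : CSpace n) : reSegment z 0 = toC (reC z) := by
  simp [reSegment]

lemma tendsto_reSegment {α : Type*} {l : Filter α} {f : α → CSpace n} {g : α → ℝ} {z : CSpace n}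
    {t : ℝ} (hf : Tendsto f l (𝓝 z)) (hg : Tendsto g l (𝓝 t)) :
    Tendsto (fun a => reSegment (f a) (g a)) l (𝓝 (reSegment z t)) := by
  have h1 := (continuous_toC.tendsto _).comp ((continuous_reC.tendsto z).comp hf)
  have h2 := (continuous_toC.tendsto _).comp (hg.smul ((continuous_imC.tendsto z).comp hf))
  exact h1.add (h2.const_smul Complex.I)

lemma norm_reSegment_le (z : CSpace n) {t : ℝ} (ht : t ∈ Icc (0 : ℝ) 1) :
    ‖reSegment z t‖ ≤ ‖z‖ := by
  refine le_of_sq_le_sq ?_ (norm_nonneg _)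
  rw [norm_sq_re_add_im (reSegment z t), norm_sq_re_add_im z, reSegment, reC_toC_add, imC_toC_add,
    norm_smul, Real.norm_of_nonneg ht.1]
  have h1 : t * ‖imC z‖ ≤ 1 * ‖imC z‖ := mul_le_mul_of_nonneg_right ht.2 (norm_nonneg _)
  rw [one_mul] at h1
  have h2 := pow_le_pow_left₀ (mul_nonneg ht.1 (norm_nonneg _)) h1 2
  linarith

lemma bform_self_eq (z : CSpace n) : bform z z =
    ((‖reC z‖ ^ 2 - ‖imC z‖ ^ 2 : ℝ) : ℂ) +
      ((2 * inner ℝ (reC z) (imC z) : ℝ) : ℂ) * Complex.I := by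
  conv_lhs => rw [← toC_re_add_im z]
  exact bform_add_I_smul _ _

lemma re_bform_self (z : CSpace n) : (bform z z).re = ‖reC z‖ ^ 2 - ‖imC z‖ ^ 2 := by
  rw [bform_self_eq]
  simp only [Complex.add_re, Complex.re_ofReal_mul, Complex.ofReal_re, Complex.I_re]
  ring

lemma im_bform_self (z : CSpace n) : (bform z z).im = 2 * inner ℝ (reC z) (imC z) := by
  rw [bform_self_eq]
  simp only [Complex.add_im, Complex.im_ofReal_mul, Complex.ofReal_im, Complex.I_im]
  ring

lemma re_bform_le_reSegment (z : CSpace n) {t : ℝ} (ht : t ∈ Icc (0 : ℝ) 1) :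
    (bform z z).re ≤ (bform (reSegment z t) (reSegment z t)).re := by
  rw [re_bform_self, re_bform_self, reSegment, reC_toC_add, imC_toC_add, norm_smul,
    Real.norm_of_nonneg ht.1]
  have h1 : t * ‖imC z‖ ≤ 1 * ‖imC z‖ := mul_le_mul_of_nonneg_right ht.2 (norm_nonneg _)
  rw [one_mul] at h1
  have h2 := pow_le_pow_left₀ (mul_nonneg ht.1 (norm_nonneg _)) h1 2
  linarith

/-- If `z²` is off the half-line of the real numbers `≤ 0`, then so are the squares of the points
between `z` and its real part. -/
lemma bform_reSegment_mem_slitPlane {z : CSpace n} (hz : bform z z ∈ Complex.slitPlane) {t : ℝ}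
    (ht : t ∈ Icc (0 : ℝ) 1) :
    bform (reSegment z t) (reSegment z t) ∈ Complex.slitPlane := by
  rw [Complex.mem_slitPlane_iff] at hz ⊢
  rcases hz with hz | hz
  · exact Or.inl (hz.trans_le (re_bform_le_reSegment z ht))
  · rw [im_bform_self] at hz
    rcases ht.1.eq_or_lt with h0 | h0
    · left
      rw [re_bform_self, ← h0, reSegment, reC_toC_add, imC_toC_add, zero_smul, norm_zero]
      have : reC z ≠ 0 := fun h => hz (by rw [h, inner_zero_left, mul_zero])
      have := norm_pos_iff.2 this
      simp only [ne_eq, OfNat.ofNat_ne_zero, not_false_eq_true, zero_pow, sub_zero]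
      positivity
    · right
      rw [im_bform_self, reSegment, reC_toC_add, imC_toC_add, inner_smul_right]
      intro h
      refine hz ?_
      have h1 : t * (2 * inner ℝ (reC z) (imC z)) = 0 := by linarith
      exact (mul_eq_zero.1 h1).resolve_left h0.ne'

/-- The part in the ball `9 ε² ‖z‖² < 1` of the wedge of the points `z` with `Re z² > 0`, which is a
neighbourhood of the punctured real space. -/
def wedge (n : ℕ) (ε : ℝ) : Set (CSpace n) :=
  {z | 0 < (bform z z).re ∧ 9 * ε ^ 2 * ‖z‖ ^ 2 < 1}

lemma isOpen_wedge (ε : ℝ) : IsOpen (wedge n ε) := by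
  refine IsOpen.inter ?_ ?_
  · exact isOpen_lt continuous_const (Complex.continuous_re.comp continuous_bform_self)
  · have h : Continuous fun z : CSpace n => 9 * ε ^ 2 * ‖z‖ ^ 2 := by fun_prop
    exact isOpen_lt h continuous_const

lemma toC_mem_wedge {ε : ℝ} {x : RSpace n} (hx : x ≠ 0) (h : 9 * ε ^ 2 * ‖x‖ ^ 2 < 1) :
    toC x ∈ wedge n ε := by
  refine ⟨?_, by rwa [norm_toC]⟩
  rw [bform_toC_self, Complex.ofReal_re]
  have := norm_pos_iff.2 hx
  positivity

/-- A set is connected if it contains a connected set of real points to which each of its points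
can be joined. -/
lemma isPreconnected_of_joined_real {W : Set (CSpace n)} {T : Set (RSpace n)}
    (hT : IsPreconnected T) (hTW : ∀ x ∈ T, toC x ∈ W)
    (h : ∀ z ∈ W, ∃ S ⊆ W, z ∈ S ∧ IsPreconnected S ∧ ∃ x ∈ T, toC x ∈ S) :
    IsPreconnected W := by
  have hT' : IsPreconnected (toC '' T) := hT.image _ continuous_toC.continuousOn
  have hTW' : toC '' T ⊆ W := by
    rintro _ ⟨x, hx, rfl⟩
    exact hTW x hx
  refine isPreconnected_of_forall_pair fun z hz w hw => ?_
  obtain ⟨S, hSW, hzS, hS, x, hx, hxS⟩ := h z hz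
  obtain ⟨S', hSW', hwS', hS', x', hx', hxS'⟩ := h w hw
  refine ⟨(S ∪ toC '' T) ∪ S', union_subset (union_subset hSW hTW') hSW', Or.inl (Or.inl hzS),
    Or.inr hwS', ?_⟩
  refine IsPreconnected.union (toC x') (Or.inr ⟨x', hx', rfl⟩) hxS' ?_ hS'
  exact IsPreconnected.union (toC x) hxS ⟨x, hx, rfl⟩ hS hT'

lemma isPreconnected_image_reSegment (z : CSpace n) :
    IsPreconnected (reSegment z '' Icc (0 : ℝ) 1) := by
  have h : Continuous (reSegment z) :=
    continuous_iff_continuousAt.2 fun _ => tendsto_reSegment tendsto_const_nhds tendsto_id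
  exact isPreconnected_Icc.image _ h.continuousOn

lemma isPreconnected_wedge [NeZero n] (hn : 2 ≤ n) (ε : ℝ) : IsPreconnected (wedge n ε) := by
  refine isPreconnected_of_joined_real (isPreconnected_puncturedBall hn ε)
    (fun x hx => toC_mem_wedge hx.1 hx.2) fun z hz => ?_
  have hmem : ∀ t ∈ Icc (0 : ℝ) 1, reSegment z t ∈ wedge n ε := fun t ht => by
    refine ⟨hz.1.trans_le (re_bform_le_reSegment z ht), lt_of_le_of_lt ?_ hz.2⟩
    have := norm_reSegment_le z ht
    gcongr
  refine ⟨reSegment z '' Icc 0 1, ?_, ⟨1, by simp, reSegment_one z⟩,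
    isPreconnected_image_reSegment z, reC z, ?_, 0, by simp, reSegment_zero z⟩
  · rintro _ ⟨t, ht, rfl⟩
    exact hmem t ht
  · have h0 := hmem 0 (by simp)
    rw [reSegment_zero] at h0
    refine ⟨fun hz0 => ?_, by simpa using h0.2⟩
    have h1 := h0.1
    rw [hz0, toC_zero] at h1
    simp [bform] at h1

end HarmonicHull

namespace HarmonicHull

open Filter Topology

/-! ### A path that keeps the conformal quotient constant -/

section Scale

/-- The argument of the square root in `scale`. -/
noncomputable def scaleSq (a q c : ℂ) : ℂ := c ^ 2 * (1 + a) ^ 2 + (1 - c ^ 2) * (1 + 2 * a + q)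

/-- The solution `m` of `m² + 2 c a m + c² q = 1 + 2 a + q` that is `1` for `c = 1` if `a` is small.
If `a = ε z₁` and `q = ε² z²`, it is the factor for which `m⁻¹ z` with the parameter `c ε` has the
same conformal quotient as `z` with the parameter `ε`. -/
noncomputable def scale (a q c : ℂ) : ℂ := -(c * a) + scaleSq a q c ^ (2⁻¹ : ℂ)

variable {a q : ℂ}

lemma scale_add_sq (a q c : ℂ) : (scale a q c + c * a) ^ 2 = scaleSq a q c := by
  rw [scale, neg_add_cancel_comm]
  exact_mod_cast Complex.cpow_nat_inv_pow _ two_ne_zero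

lemma scale_equation (a q c : ℂ) :
    scale a q c ^ 2 + 2 * (c * a) * scale a q c + c ^ 2 * q = 1 + 2 * a + q := by
  have h := scale_add_sq a q c
  rw [scaleSq] at h
  linear_combination h

variable (ha : ‖a‖ < 1 / 3) (hq : ‖q‖ < 1 / 9)
include ha hq

lemma re_scaleSq_pos {σ : ℝ} (hσ : σ ∈ Icc (0 : ℝ) 1) : 0 < (scaleSq a q σ).re := by
  have h1 := (abs_le.1 (Complex.abs_re_le_norm a)).1
  have h2 := (abs_le.1 (Complex.abs_im_le_norm a))
  have h3 := (abs_le.1 (Complex.abs_re_le_norm q)).1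
  have h4 : (scaleSq a q σ).re =
      σ ^ 2 * ((1 + a.re) ^ 2 - a.im ^ 2) + (1 - σ ^ 2) * (1 + 2 * a.re + q.re) := by
    simp [scaleSq, sq]
  have h5 : 0 < (1 + a.re) ^ 2 - a.im ^ 2 := by nlinarith
  have h6 : 0 < 1 + 2 * a.re + q.re := by linarith
  have h7 : σ ^ 2 ≤ 1 := pow_le_one₀ hσ.1 hσ.2
  rw [h4]
  rcases hσ.1.eq_or_lt with h0 | h0
  · rw [← h0]
    linarith
  · have h8 : 0 < σ ^ 2 := by positivity
    have h9 := mul_pos h8 h5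
    have h10 := mul_nonneg (sub_nonneg.2 h7) h6.le
    linarith

lemma scale_add_ne_zero {σ : ℝ} (hσ : σ ∈ Icc (0 : ℝ) 1) : scale a q σ + σ * a ≠ 0 := by
  intro h
  have h1 := scale_add_sq a q σ
  have h2 := re_scaleSq_pos ha hq hσ
  rw [← h1, h] at h2
  norm_num at h2

lemma hasDerivAt_scale {σ : ℝ} (hσ : σ ∈ Icc (0 : ℝ) 1) :
    HasDerivAt (fun t : ℝ => scale a q t)
      (-(a * scale a q σ + σ * q) / (scale a q σ + σ * a)) σ := by
  have hS := re_scaleSq_pos ha hq hσ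
  have hp := scale_add_ne_zero ha hq hσ
  have hsq := scale_add_sq a q σ
  have h1 : HasDerivAt (fun c : ℂ => scaleSq a q c) (2 * σ * (a ^ 2 - q)) (σ : ℂ) := by
    have h2 := (hasDerivAt_id (σ : ℂ)).pow 2
    have h3 := (h2.mul_const ((1 + a) ^ 2)).add ((h2.const_sub 1).mul_const (1 + 2 * a + q))
    refine h3.congr_deriv ?_
    simp
    ring
  have h2 := h1.cpow_const (c := (2⁻¹ : ℂ)) (Or.inl hS)
  have h3 := (((hasDerivAt_id (σ : ℂ)).mul_const a).neg).add h2
  refine HasDerivAt.comp_ofReal (e := fun c => scale a q c) (h3.congr_deriv ?_)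
  have hS0 : scaleSq a q σ ≠ 0 := fun h => by rw [h] at hS; exact lt_irrefl _ hS
  have hpow : scaleSq a q σ ^ (2⁻¹ : ℂ) = scale a q σ + σ * a := by
    rw [scale, neg_add_cancel_comm]
  rw [Complex.cpow_sub _ _ hS0, Complex.cpow_one, hpow, ← hsq]
  obtain ⟨p, hpdef⟩ : ∃ p, p = scale a q σ + σ * a := ⟨_, rfl⟩
  have hscale : scale a q σ = p - σ * a := by rw [hpdef, add_sub_cancel_right]
  rw [← hpdef] at hp ⊢
  rw [hscale]
  field_simp
  ring

/-- A barrier argument: `σ² - |scale|²` vanishes at `σ = 1`, and as `σ` decreases from `1` to `0` it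
is decreasing wherever it vanishes, so that it cannot become positive. -/
lemma le_norm_scale {σ : ℝ} (hσ : σ ∈ Icc (0 : ℝ) 1) : σ ≤ ‖scale a q σ‖ := by
  set m' : ℝ → ℂ := fun σ => -(a * scale a q σ + σ * q) / (scale a q σ + σ * a) with hm'
  have hmem : ∀ {t : ℝ}, t ∈ Icc (0 : ℝ) 1 → 1 - t ∈ Icc (0 : ℝ) 1 := fun ht =>
    ⟨by linarith [ht.2], by linarith [ht.1]⟩
  have hderiv : ∀ t ∈ Icc (0 : ℝ) 1, HasDerivAt
      (fun t : ℝ => (1 - t) ^ 2 - ‖scale a q ((1 - t : ℝ) : ℂ)‖ ^ 2)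
      (-2 * (1 - t) + 2 * inner ℝ (scale a q ((1 - t : ℝ) : ℂ)) (m' (1 - t))) t := by
    intro t ht
    have h0 : HasDerivAt (fun t : ℝ => 1 - t) (-1) t := (hasDerivAt_id t).const_sub 1
    have h1 : HasDerivAt (fun t : ℝ => scale a q ((1 - t : ℝ) : ℂ)) (-m' (1 - t)) t := by
      refine ((hasDerivAt_scale ha hq (hmem ht)).scomp t h0).congr_deriv ?_
      simp [hm']
    refine ((h0.pow 2).sub h1.norm_sq).congr_deriv ?_
    rw [inner_neg_right]
    simp
    ring
  have hone : scale a q ((1 - 0 : ℝ) : ℂ) = 1 := by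
    have h1 := (abs_le.1 (Complex.abs_re_le_norm a)).1
    have h2 : scaleSq a q ((1 - 0 : ℝ) : ℂ) = (1 + a) ^ 2 := by simp [scaleSq]
    rw [scale, h2, Complex.sq_cpow_two_inv]
    · simp
    · rw [Complex.add_re, Complex.one_re]
      linarith
  have key := image_le_of_deriv_right_lt_deriv_boundary (a := 0) (b := 1) (B := fun _ => 0)
    (B' := fun _ => 0) (fun t ht => (hderiv t ht).continuousAt.continuousWithinAt)
    (fun t ht => (hderiv t ⟨ht.1, ht.2.le⟩).hasDerivWithinAt) (by simp only [hone]; norm_num)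
    (fun t => hasDerivAt_const t (0 : ℝ)) ?_ (hmem hσ)
  · simp only [sub_sub_cancel] at key
    refine le_of_sq_le_sq ?_ (norm_nonneg _)
    linarith
  · intro t ht h0
    set τ : ℝ := 1 - t with hτ
    have hτ0 : 0 < τ := by linarith [ht.2]
    have hnorm : ‖scale a q τ‖ = τ := by
      have h1 : ‖scale a q τ‖ ^ 2 = τ ^ 2 := by linarith
      exact (pow_left_inj₀ (norm_nonneg _) hτ0.le two_ne_zero).1 h1
    have h2 : ‖a * scale a q τ + τ * q‖ ≤ τ * (4 / 9) := by
      refine (norm_add_le _ _).trans ?_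
      rw [norm_mul, norm_mul, hnorm, Complex.norm_real, Real.norm_of_nonneg hτ0.le]
      nlinarith
    have h3 : τ * (2 / 3) ≤ ‖scale a q τ + τ * a‖ := by
      have h4 := norm_sub_le_norm_add (scale a q τ) (τ * a)
      rw [norm_mul, hnorm, Complex.norm_real, Real.norm_of_nonneg hτ0.le] at h4
      nlinarith
    have h5 : ‖m' τ‖ ≤ 2 / 3 := by
      simp only [hm']
      have h0 : 0 < ‖scale a q τ + τ * a‖ := lt_of_lt_of_le (by positivity) h3
      rw [norm_div, norm_neg, div_le_iff₀ h0]
      linarith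
    have h6 := real_inner_le_norm (scale a q τ) (m' τ)
    rw [hnorm] at h6
    have h7 := mul_le_mul_of_nonneg_left h5 hτ0.le
    linarith

lemma scale_ne_zero {σ : ℝ} (hσ : σ ∈ Icc (0 : ℝ) 1) : scale a q σ ≠ 0 := by
  rcases hσ.1.eq_or_lt with h0 | h0
  · simpa [← h0] using scale_add_ne_zero ha hq hσ
  · exact norm_pos_iff.1 (h0.trans_le (le_norm_scale ha hq hσ))

omit hq in
lemma scale_one : scale a q 1 = 1 := by
  have h1 := (abs_le.1 (Complex.abs_re_le_norm a)).1
  have h2 : scaleSq a q 1 = (1 + a) ^ 2 := by simp [scaleSq]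
  rw [scale, h2, Complex.sq_cpow_two_inv]
  · simp
  · rw [Complex.add_re, Complex.one_re]
    linarith

end Scale

/-! ### Connectedness of the curved hulls -/

variable {n : ℕ} [NeZero n]

lemma isOpen_setOf_mem_curvedHull : IsOpen {p : ℝ × CSpace n | p.2 ∈ curvedHull n p.1} := by
  have h1 : Continuous fun p : ℝ × CSpace n => 9 * p.1 ^ 2 * ‖p.2‖ ^ 2 := by fun_prop
  have h2 : Continuous fun p : ℝ × CSpace n => bform p.2 p.2 :=
    continuous_bform_self.comp continuous_snd
  have h3 : Continuous fun p : ℝ × CSpace n => confDenom p.1 p.2 := by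
    unfold confDenom
    have : Continuous fun p : ℝ × CSpace n => p.2 0 :=
      (differentiable_apply 0).continuous.comp continuous_snd
    fun_prop
  have h4 : ContinuousOn (fun p : ℝ × CSpace n => bform p.2 p.2 / confDenom p.1 p.2)
      {p | 9 * p.1 ^ 2 * ‖p.2‖ ^ 2 < 1} :=
    h2.continuousOn.div h3.continuousOn fun p hp => confDenom_ne_zero hp
  exact h4.isOpen_inter_preimage (isOpen_lt h1 continuous_const) Complex.isOpen_slitPlane

lemma isOpen_curvedHull (ε : ℝ) : IsOpen (curvedHull n ε) :=
  isOpen_setOf_mem_curvedHull.preimage (Continuous.prodMk_right ε)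

lemma ofReal_mul_mem_slitPlane {r : ℝ} (hr : 0 < r) {w : ℂ} (hw : w ∈ Complex.slitPlane) :
    (r : ℂ) * w ∈ Complex.slitPlane := by
  rw [Complex.mem_slitPlane_iff] at hw ⊢
  rw [Complex.re_ofReal_mul, Complex.im_ofReal_mul]
  exact hw.imp (mul_pos hr) (mul_ne_zero hr.ne')

lemma smul_mem_curvedHull {σ ε : ℝ} (hσ : 0 < σ) {w : CSpace n}
    (hw : w ∈ curvedHull n (σ * ε)) : (σ : ℂ) • w ∈ curvedHull n ε := by
  have hD : confDenom ε ((σ : ℂ) • w) = confDenom (σ * ε) w := by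
    rw [confDenom, confDenom, bform_smul_self, PiLp.smul_apply, smul_eq_mul]
    push_cast
    ring
  refine ⟨?_, ?_⟩
  · rw [norm_smul, Complex.norm_real, Real.norm_of_nonneg hσ.le]
    have := hw.1
    nlinarith
  · rw [hD, bform_smul_self, mul_div_assoc]
    have := ofReal_mul_mem_slitPlane (pow_pos hσ 2) hw.2
    rwa [Complex.ofReal_pow] at this

/-- Scaling a point `z` of `curvedHull n ε` down along the path of constant conformal quotient and
back up by the scaling of the parameter. The value at `σ = 0` lies in `curvedHull n 0`. -/
noncomputable def scalePath (ε : ℝ) (z : CSpace n) (σ : ℝ) : CSpace n :=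
  (scale (ε * z 0) (ε ^ 2 * bform z z) σ)⁻¹ • z

lemma scalePath_mem_curvedHull {ε : ℝ} {z : CSpace n} (hz : z ∈ curvedHull n ε) {σ : ℝ}
    (hσ : σ ∈ Icc (0 : ℝ) 1) : scalePath ε z σ ∈ curvedHull n (σ * ε) := by
  obtain ⟨ha, hq⟩ := norm_lt_of_ball hz.1
  have hm := scale_ne_zero ha hq hσ
  have hle := le_norm_scale ha hq hσ
  have heq := scale_equation (ε * z 0) (ε ^ 2 * bform z z) σ
  rw [scalePath]
  set m := scale (ε * z 0) (ε ^ 2 * bform z z) σ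
  refine ⟨?_, ?_⟩
  · have hmpos : 0 < ‖m‖ := norm_pos_iff.2 hm
    have h1 : σ * ‖m‖⁻¹ ≤ 1 := by
      rw [← div_eq_mul_inv]
      exact (div_le_one hmpos).2 hle
    have h2 : (σ * ‖m‖⁻¹) ^ 2 ≤ 1 := pow_le_one₀ (mul_nonneg hσ.1 (by positivity)) h1
    have h3 := hz.1
    rw [norm_smul, norm_inv]
    calc 9 * (σ * ε) ^ 2 * (‖m‖⁻¹ * ‖z‖) ^ 2
        = (σ * ‖m‖⁻¹) ^ 2 * (9 * ε ^ 2 * ‖z‖ ^ 2) := by ring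
      _ ≤ 1 * (9 * ε ^ 2 * ‖z‖ ^ 2) := mul_le_mul_of_nonneg_right h2 (by positivity)
      _ < 1 := by linarith
  · have hD : confDenom (σ * ε) (m⁻¹ • z) = (m⁻¹) ^ 2 * confDenom ε z := by
      rw [confDenom_eq ε z, ← heq, confDenom, bform_smul_self, PiLp.smul_apply, smul_eq_mul]
      push_cast
      field_simp
    rw [hD, bform_smul_self, mul_div_mul_left _ _ (pow_ne_zero 2 (inv_ne_zero hm))]
    exact hz.2

lemma continuousAt_scalePath {ε : ℝ} {z : CSpace n} (hz : z ∈ curvedHull n ε) {σ : ℝ}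
    (hσ : σ ∈ Icc (0 : ℝ) 1) : ContinuousAt (scalePath ε z) σ := by
  obtain ⟨ha, hq⟩ := norm_lt_of_ball hz.1
  exact ((hasDerivAt_scale ha hq hσ).continuousAt.inv₀ (scale_ne_zero ha hq hσ)).smul
    continuousAt_const

/-- The segments from the real parts to the points of a path stay in the curved hulls of small
parameter if the path starts in `curvedHull n 0`. -/
lemma eventually_reSegment_mem_curvedHull {w : ℝ → CSpace n} (hwc : ContinuousAt w 0)
    (hw0 : w 0 ∈ curvedHull n 0) (ε : ℝ) :
    ∀ᶠ σ in 𝓝 (0 : ℝ), ∀ t ∈ Icc (0 : ℝ) 1, reSegment (w σ) t ∈ curvedHull n (σ * ε) := by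
  refine isCompact_Icc.eventually_forall_of_forall_eventually fun t ht => ?_
  have hmem : ((0 : ℝ) * ε, reSegment (w 0) t) ∈ {p : ℝ × CSpace n | p.2 ∈ curvedHull n p.1} := by
    have h0 := hw0.2
    rw [confDenom_zero, div_one] at h0
    change _ ∈ curvedHull n (0 * ε)
    rw [zero_mul]
    refine ⟨by norm_num, ?_⟩
    rw [confDenom_zero, div_one]
    exact bform_reSegment_mem_slitPlane h0 ht
  have h1 : Tendsto (fun p : ℝ × ℝ => w p.1) (𝓝 (0, t)) (𝓝 (w 0)) :=
    hwc.tendsto.comp continuous_fst.continuousAt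
  have h2 : Tendsto (fun p : ℝ × ℝ => p.2) (𝓝 ((0 : ℝ), t)) (𝓝 t) :=
    continuous_snd.continuousAt
  have h3 : Tendsto (fun p : ℝ × ℝ => reSegment (w p.1) p.2) (𝓝 (0, t))
      (𝓝 (reSegment (w 0) t)) := tendsto_reSegment h1 h2
  have h4 : Tendsto (fun p : ℝ × ℝ => p.1 * ε) (𝓝 ((0 : ℝ), t)) (𝓝 (0 * ε)) :=
    (continuous_fst.mul continuous_const).tendsto ((0 : ℝ), t)
  exact (h4.prodMk_nhds h3).eventually (isOpen_setOf_mem_curvedHull.mem_nhds hmem)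

/-- Every point of a curved hull is first moved towards the origin, with a constant conformal
quotient; near the origin the curved hull looks like `curvedHull n 0`, where points can be joined
to their real parts. -/
theorem isPreconnected_curvedHull (hn : 2 ≤ n) (ε : ℝ) : IsPreconnected (curvedHull n ε) := by
  refine isPreconnected_of_joined_real (isPreconnected_puncturedBall hn ε)
    (fun x hx => toC_mem_curvedHull hx.1 hx.2) fun z hz => ?_
  set w := scalePath ε z with hw
  have h01 : (0 : ℝ) ∈ Icc (0 : ℝ) 1 := by simp
  have hw0 : w 0 ∈ curvedHull n 0 := by
    have := scalePath_mem_curvedHull hz h01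
    rwa [zero_mul] at this
  have htube := eventually_reSegment_mem_curvedHull (continuousAt_scalePath hz h01) hw0 ε
  obtain ⟨σ₀, hσ₀, hσ₀1, hσ₀t⟩ : ∃ σ₀ : ℝ, 0 < σ₀ ∧ σ₀ < 1 ∧
      ∀ t ∈ Icc (0 : ℝ) 1, reSegment (w σ₀) t ∈ curvedHull n (σ₀ * ε) := by
    have h1 : ∀ᶠ σ in 𝓝[>] (0 : ℝ), σ ∈ Ioo (0 : ℝ) 1 := Ioo_mem_nhdsGT one_pos
    obtain ⟨σ, hσ, hσt⟩ := (h1.and (htube.filter_mono nhdsWithin_le_nhds)).exists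
    exact ⟨σ, hσ.1, hσ.2, hσt⟩
  set S₁ : Set (CSpace n) := (fun σ : ℝ => (σ : ℂ) • w σ) '' Icc σ₀ 1 with hS₁
  set S₂ : Set (CSpace n) :=
    (fun v => (σ₀ : ℂ) • v) '' (reSegment (w σ₀) '' Icc (0 : ℝ) 1) with hS₂
  have hS₁W : S₁ ⊆ curvedHull n ε := by
    rintro _ ⟨σ, hσ, rfl⟩
    exact smul_mem_curvedHull (hσ₀.trans_le hσ.1)
      (scalePath_mem_curvedHull hz ⟨hσ₀.le.trans hσ.1, hσ.2⟩)
  have hS₂W : S₂ ⊆ curvedHull n ε := by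
    rintro _ ⟨_, ⟨t, ht, rfl⟩, rfl⟩
    exact smul_mem_curvedHull hσ₀ (hσ₀t t ht)
  have hreal : toC (σ₀ • reC (w σ₀)) ∈ S₂ :=
    ⟨toC (reC (w σ₀)), ⟨0, h01, reSegment_zero _⟩, (toC_smul _ _).symm⟩
  refine ⟨S₁ ∪ S₂, union_subset hS₁W hS₂W, Or.inl ⟨1, ⟨hσ₀1.le, le_rfl⟩, ?_⟩, ?_,
    σ₀ • reC (w σ₀), ⟨fun h0 => ?_, ?_⟩, Or.inr hreal⟩
  · have ha := (norm_lt_of_ball hz.1).1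
    simp only [hw, scalePath, Complex.ofReal_one, scale_one ha, inv_one, one_smul]
  · refine IsPreconnected.union ((σ₀ : ℂ) • w σ₀) ⟨σ₀, ⟨le_rfl, hσ₀1.le⟩, rfl⟩
      ⟨w σ₀, ⟨1, by simp, reSegment_one _⟩, rfl⟩ ?_ ?_
    · refine isPreconnected_Icc.image _ fun σ hσ => ContinuousAt.continuousWithinAt ?_
      exact Complex.continuous_ofReal.continuousAt.smul
        (continuousAt_scalePath hz ⟨hσ₀.le.trans hσ.1, hσ.2⟩)
    · exact (isPreconnected_image_reSegment _).image _ (continuous_const_smul _).continuousOn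
  · have h1 := bform_ne_zero_of_mem_curvedHull (hS₂W hreal)
    rw [h0, toC_zero] at h1
    simp [bform] at h1
  · simpa only [norm_toC] using (hS₂W hreal).1

end HarmonicHull

namespace HarmonicHull

open Filter Topology

variable {n : ℕ}

/-! ### Rotations -/

section Rotation

variable {A B : Matrix (Fin n) (Fin n) ℝ}

lemma matAct_apply (A : Matrix (Fin n) (Fin n) ℝ) (z : CSpace n) (i : Fin n) :
    matAct A z i = ∑ j, (A i j : ℂ) * z j := rfl

lemma matAct_one (z : CSpace n) : matAct 1 z = z := by
  ext i
  simp [matAct]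

lemma matAct_mul (A B : Matrix (Fin n) (Fin n) ℝ) (z : CSpace n) :
    matAct A (matAct B z) = matAct (A * B) z := by
  have h : (A * B).map (fun t : ℝ => (t : ℂ)) =
      A.map (fun t : ℝ => (t : ℂ)) * B.map (fun t : ℝ => (t : ℂ)) :=
    Matrix.map_mul (f := Complex.ofRealHom)
  ext i
  simp only [matAct, h, Matrix.mulVec_mulVec]

lemma differentiable_matAct (A : Matrix (Fin n) (Fin n) ℝ) : Differentiable ℂ (matAct A) := by
  rw [differentiable_euclidean]
  intro i
  simp only [matAct_apply]
  fun_prop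

lemma bform_matAct_left (A : Matrix (Fin n) (Fin n) ℝ) (z w : CSpace n) :
    bform (matAct A z) w = bform z (matAct A.transpose w) := by
  simp only [bform, matAct_apply, Finset.sum_mul, Finset.mul_sum]
  rw [Finset.sum_comm]
  refine Finset.sum_congr rfl fun i _ => Finset.sum_congr rfl fun j _ => ?_
  rw [Matrix.transpose_apply]
  ring

lemma bform_matAct_self (hA : A.transpose * A = 1) (z : CSpace n) :
    bform (matAct A z) (matAct A z) = bform z z := by
  rw [bform_matAct_left, matAct_mul, hA, matAct_one]

lemma matAct_toC (A : Matrix (Fin n) (Fin n) ℝ) (x : RSpace n) :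
    matAct A (toC x) = toC (WithLp.toLp 2 (A.mulVec x.ofLp)) := by
  ext i
  simp [matAct_apply, Matrix.mulVec, dotProduct]

lemma norm_matAct (hA : A.transpose * A = 1) (z : CSpace n) : ‖matAct A z‖ = ‖z‖ := by
  have hreal : ∀ x : RSpace n, ‖(WithLp.toLp 2 (A.mulVec x.ofLp) : RSpace n)‖ ^ 2 = ‖x‖ ^ 2 := by
    intro x
    have h := bform_matAct_self hA (toC x)
    rw [matAct_toC, bform_toC_self, bform_toC_self] at h
    exact_mod_cast h
  have hsplit : matAct A z = toC (WithLp.toLp 2 (A.mulVec (reC z).ofLp)) +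
      Complex.I • toC (WithLp.toLp 2 (A.mulVec (imC z).ofLp)) := by
    rw [← matAct_toC, ← matAct_toC]
    ext i
    simp only [matAct_apply, PiLp.add_apply, PiLp.smul_apply, smul_eq_mul, Finset.mul_sum,
      ← Finset.sum_add_distrib, toC_apply, reC_apply, imC_apply]
    refine Finset.sum_congr rfl fun j _ => ?_
    conv_lhs => rw [← Complex.re_add_im (z j)]
    ring
  refine (pow_left_inj₀ (norm_nonneg _) (norm_nonneg _) two_ne_zero).1 ?_
  rw [hsplit, norm_sq_re_add_im, reC_toC_add, imC_toC_add, hreal, hreal, ← norm_sq_re_add_im]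

lemma transpose_mul_self_of_mem (hA : A ∈ Matrix.specialOrthogonalGroup (Fin n) ℝ) :
    A.transpose * A = 1 ∧ A * A.transpose = 1 := by
  have h1 := (Matrix.mem_specialOrthogonalGroup_iff.1 hA).1
  exact ⟨(Matrix.mem_orthogonalGroup_iff' (Fin n) ℝ).1 h1,
    (Matrix.mem_orthogonalGroup_iff (Fin n) ℝ).1 h1⟩

lemma image_matAct_eq (hA : A.transpose * A = 1) (hA' : A * A.transpose = 1) (S : Set (CSpace n)) :
    matAct A '' S = matAct A.transpose ⁻¹' S := by
  refine congrFun (image_eq_preimage_of_inverse ?_ ?_) S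
  · intro z
    rw [matAct_mul, hA, matAct_one]
  · intro z
    rw [matAct_mul, hA', matAct_one]

/-- A signed permutation matrix that exchanges the first coordinate and another one is a
rotation. -/
lemma exists_rotation_apply_zero [NeZero n] (i : Fin n) :
    ∃ A ∈ Matrix.specialOrthogonalGroup (Fin n) ℝ, ∃ s : ℝ, s ≠ 0 ∧
      ∀ z : CSpace n, matAct A.transpose z 0 = s * z i := by
  by_cases hi : i = 0
  · refine ⟨1, one_mem _, 1, one_ne_zero, fun z => ?_⟩
    rw [Matrix.transpose_one, matAct_one, hi]
    simp
  · set d : Fin n → ℝ := Function.update 1 0 (-1) with hd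
    set P : Matrix (Fin n) (Fin n) ℝ := (Equiv.swap 0 i).permMatrix ℝ with hP
    set D : Matrix (Fin n) (Fin n) ℝ := Matrix.diagonal d with hD
    have hDD : D * D = 1 := by
      rw [hD, Matrix.diagonal_mul_diagonal, ← Matrix.diagonal_one]
      congr 1
      ext j
      by_cases hj : j = 0
      · simp [hd, hj]
      · simp [hd, hj]
    have hPP : P * P = 1 := by
      rw [hP, ← Matrix.permMatrix_mul, Equiv.swap_mul_self, Matrix.permMatrix_one]
    have hPt : P.transpose = P := by
      rw [hP, Matrix.transpose_permMatrix, Equiv.swap_inv]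
    have hDt : D.transpose = D := Matrix.diagonal_transpose d
    refine ⟨P * D, ?_, -1, by norm_num, fun z => ?_⟩
    · rw [Matrix.mem_specialOrthogonalGroup_iff, Matrix.mem_orthogonalGroup_iff]
      refine ⟨?_, ?_⟩
      · rw [Matrix.transpose_mul, hPt, hDt, Matrix.mul_assoc, ← Matrix.mul_assoc D, hDD,
          Matrix.one_mul, hPP]
      · rw [Matrix.det_mul, hP, Matrix.det_permutation, Equiv.Perm.sign_swap (Ne.symm hi), hD,
          Matrix.det_diagonal, hd, Finset.prod_update_of_mem (Finset.mem_univ _)]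
        simp
    · rw [Matrix.transpose_mul, hPt, hDt, matAct_apply, Finset.sum_eq_single i]
      · rw [hD, Matrix.diagonal_mul, hP]
        simp [hd, Equiv.Perm.permMatrix, PEquiv.toMatrix_apply]
      · intro j _ hj
        rw [hD, Matrix.diagonal_mul, hP]
        simp [Equiv.Perm.permMatrix, PEquiv.toMatrix_apply, Ne.symm hj]
      · simp

end Rotation

/-! ### Extension domains -/

lemma ExtendsTo.mono {U : Set (RSpace n)} {u : RSpace n → ℂ} {V W : Set (CSpace n)}
    (h : ExtendsTo U u W) (hVW : V ⊆ W) : ExtendsTo U u V := by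
  obtain ⟨g, hg, hgu⟩ := h
  exact ⟨g, hg.mono hVW, fun x hx hxV => hgu x hx (hVW hxV)⟩

/-- Extensions to two open sets with a connected intersection that contains a point of `U` agree on
the intersection. -/
lemma ExtendsTo.union {U : Set (RSpace n)} (hU : IsOpen U) {u : RSpace n → ℂ}
    {V W : Set (CSpace n)} (hV : IsOpen V) (hW : IsOpen W) (hVW : IsPreconnected (V ∩ W))
    (hne : ∃ x ∈ U, toC x ∈ V ∩ W) (h₁ : ExtendsTo U u V) (h₂ : ExtendsTo U u W) :
    ExtendsTo U u (V ∪ W) := by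
  classical
  obtain ⟨g₁, hg₁, hgu₁⟩ := h₁
  obtain ⟨g₂, hg₂, hgu₂⟩ := h₂
  obtain ⟨x₀, hx₀, hx₀VW⟩ := hne
  have heq : EqOn g₁ g₂ (V ∩ W) := by
    refine eqOn_of_eventually_real (hV.inter hW) hVW (hg₁.mono inter_subset_left)
      (hg₂.mono inter_subset_right) hx₀VW ?_
    filter_upwards [hU.mem_nhds hx₀,
      continuous_toC.continuousAt.eventually ((hV.inter hW).mem_nhds hx₀VW)] with x hx hxVW
    rw [hgu₁ x hx hxVW.1, hgu₂ x hx hxVW.2]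
  set g : CSpace n → ℂ := fun z => if z ∈ V then g₁ z else g₂ z with hg
  have hgV : EqOn g g₁ V := fun z hz => if_pos hz
  have hgW : EqOn g g₂ W := fun z hz => by
    by_cases hzV : z ∈ V
    · rw [hgV hzV, heq ⟨hzV, hz⟩]
    · exact if_neg hzV
  refine ⟨g, ?_, ?_⟩
  · exact (hg₁.congr hgV).union_of_isOpen (hg₂.congr hgW) hV hW
  · rintro x hx (hxV | hxW)
    · rw [hgV hxV, hgu₁ x hx hxV]
    · rw [hgW hxW, hgu₂ x hx hxW]

variable [NeZero n]

lemma exists_mem_puncturedBall (ε : ℝ) :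
    ∃ x : RSpace n, x ≠ 0 ∧ 9 * ε ^ 2 * ‖x‖ ^ 2 < 1 := by
  have h : 0 < 1 + 3 * |ε| := by positivity
  have hx : ‖(1 + 3 * |ε|)⁻¹ • e₁ n‖ = (1 + 3 * |ε|)⁻¹ := by
    rw [norm_smul, Real.norm_of_nonneg (by positivity)]
    simp [e₁]
  refine ⟨(1 + 3 * |ε|)⁻¹ • e₁ n, ?_, ?_⟩
  · rw [← norm_pos_iff, hx]
    positivity
  · rw [hx]
    have h1 : 3 * |ε| * (1 + 3 * |ε|)⁻¹ < 1 := by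
      rw [← div_eq_mul_inv, div_lt_one h]
      linarith
    calc 9 * ε ^ 2 * (1 + 3 * |ε|)⁻¹ ^ 2 = (3 * |ε| * (1 + 3 * |ε|)⁻¹) ^ 2 := by
          rw [mul_pow, mul_pow, sq_abs]
          norm_num
      _ < 1 := pow_lt_one₀ (by positivity) h1 two_ne_zero

/-- The rotated curved hulls are extension domains. -/
theorem isExtensionDomain_image_curvedHull (hn : 3 ≤ n) {A : Matrix (Fin n) (Fin n) ℝ}
    (hA : A ∈ Matrix.specialOrthogonalGroup (Fin n) ℝ) (ε : ℝ) :
    IsExtensionDomain ({0}ᶜ : Set (RSpace n)) (matAct A '' curvedHull n ε) := by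
  obtain ⟨h1, h2⟩ := transpose_mul_self_of_mem hA
  have h1' : A.transpose.transpose * A.transpose = 1 := by rwa [Matrix.transpose_transpose]
  have himage := image_matAct_eq h1 h2 (curvedHull n ε)
  obtain ⟨x, hx0, hx⟩ := exists_mem_puncturedBall (n := n) ε
  have hxmem := toC_mem_curvedHull hx0 hx
  have hconj : DifferentiableOn ℂ (matAct A.transpose) (matAct A '' curvedHull n ε) :=
    (differentiable_matAct _).differentiableOn
  have hmaps : MapsTo (matAct A.transpose) (matAct A '' curvedHull n ε) (curvedHull n ε) := by
    rw [himage]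
    exact mapsTo_preimage _ _
  refine ⟨?_, ⟨⟨_, _, hxmem, rfl⟩, ?_⟩, ?_, fun u hu => ?_⟩
  · rw [himage]
    exact (isOpen_curvedHull ε).preimage (differentiable_matAct _).continuous
  · exact (isPreconnected_curvedHull (by omega) ε).image _
      (differentiable_matAct A).continuous.continuousOn
  · refine ⟨WithLp.toLp 2 (A.mulVec x.ofLp), fun h0 => ?_, toC x, hxmem, matAct_toC A x⟩
    have h3 := norm_matAct h1 (toC x)
    rw [matAct_toC, h0, toC_zero, norm_zero, norm_toC] at h3
    exact hx0 (norm_eq_zero.1 h3.symm)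
  · refine extendsTo_of_sqrt hn (σ := fun z => curvedSqrt ε (matAct A.transpose z))
      ((differentiableOn_curvedSqrt ε).comp hconj hmaps) (fun z hz => ?_) (fun z hz => ?_)
      (fun y hy hyW => ?_) hu
    · rw [curvedSqrt_sq (hmaps hz), bform_matAct_self h1']
    · rw [← bform_matAct_self h1' z]
      exact bform_ne_zero_of_mem_curvedHull (hmaps hz)
    · have h3 := hmaps hyW
      have h4 := norm_matAct h1' (toC y)
      rw [matAct_toC] at h3 h4 ⊢
      rw [curvedSqrt_toC h3]
      rw [norm_toC, norm_toC] at h4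
      rw [h4]

/-- The union of a rotated curved hull and a wedge around the punctured real space is an extension
domain. -/
theorem isExtensionDomain_wedge_union (hn : 3 ≤ n) {A : Matrix (Fin n) (Fin n) ℝ}
    (hA : A ∈ Matrix.specialOrthogonalGroup (Fin n) ℝ) (ε : ℝ) :
    IsExtensionDomain ({0}ᶜ : Set (RSpace n)) (wedge n 0 ∪ matAct A '' curvedHull n ε) := by
  obtain ⟨h1, h2⟩ := transpose_mul_self_of_mem hA
  have h1' : A.transpose.transpose * A.transpose = 1 := by rwa [Matrix.transpose_transpose]
  have hE := isExtensionDomain_image_curvedHull hn hA ε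
  have h0 := isExtensionDomain_image_curvedHull hn (one_mem _) (0 : ℝ)
  have hwedge : wedge n 0 ⊆ matAct 1 '' curvedHull n 0 := fun z hz =>
    ⟨z, ⟨hz.2, div_confDenom_mem_slitPlane hz.2 hz.1⟩, matAct_one z⟩
  have hinter : wedge n 0 ∩ matAct A '' curvedHull n ε = wedge n ε := by
    rw [image_matAct_eq h1 h2]
    ext z
    constructor
    · rintro ⟨hz, hz'⟩
      refine ⟨hz.1, ?_⟩
      have := hz'.1
      rwa [norm_matAct h1'] at this
    · intro hz
      have h3 : 9 * ε ^ 2 * ‖matAct A.transpose z‖ ^ 2 < 1 := by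
        rw [norm_matAct h1']
        exact hz.2
      refine ⟨⟨hz.1, by norm_num⟩, h3, div_confDenom_mem_slitPlane h3 ?_⟩
      rw [bform_matAct_self h1']
      exact hz.1
  obtain ⟨x, hx0, hx⟩ := exists_mem_puncturedBall (n := n) ε
  have hxmem : toC x ∈ wedge n 0 ∩ matAct A '' curvedHull n ε := by
    rw [hinter]
    exact toC_mem_wedge hx0 hx
  have hpre : IsPreconnected (wedge n 0 ∩ matAct A '' curvedHull n ε) := by
    rw [hinter]
    exact isPreconnected_wedge (by omega) ε
  refine ⟨(isOpen_wedge 0).union hE.isOpen, ⟨⟨_, Or.inl hxmem.1⟩, ?_⟩,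
    ⟨x, hx0, Or.inl hxmem.1⟩, fun u hu => ?_⟩
  · exact (isPreconnected_wedge (by omega) 0).union _ hxmem.1 hxmem.2 hE.isConnected.isPreconnected
  · exact ExtendsTo.union isOpen_compl_singleton (isOpen_wedge 0) hE.isOpen hpre ⟨x, hx0, hxmem⟩
      ((h0.extends_harmonic u hu).mono hwedge) (hE.extends_harmonic u hu)

/-! ### The rotated curved hulls cover the complement of the null cone -/

theorem setOf_bform_ne_zero_eq_iUnion :
    {z : CSpace n | bform z z ≠ 0} = ⋃ A ∈ Matrix.specialOrthogonalGroup (Fin n) ℝ, ⋃ ε : ℝ,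
      matAct A '' curvedHull n ε := by
  refine subset_antisymm (fun z hz => ?_) ?_
  · simp only [mem_iUnion]
    by_cases hslit : bform z z ∈ Complex.slitPlane
    · refine ⟨1, one_mem _, 0, z, ⟨by norm_num, ?_⟩, matAct_one z⟩
      rwa [confDenom_zero, div_one]
    -- now `z²` is negative, hence `z` is not real, and a rotation makes `Im z₁` nonzero, and
    -- with it the imaginary part of the denominator for small `ε`
    · rw [Complex.mem_slitPlane_iff, not_or, not_lt, ne_eq, not_not] at hslit
      obtain ⟨i, hi⟩ : ∃ i, (z i).im ≠ 0 := by
        by_contra! h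
        have hzr : z = toC (reC z) := by
          ext i
          exact Complex.ext (by simp) (by simp [h i])
        have h1 := hslit.1
        rw [hzr, bform_toC_self, Complex.ofReal_re] at h1
        have h2 : reC z = 0 := by
          rw [← norm_eq_zero]
          exact pow_eq_zero_iff two_ne_zero |>.1 (le_antisymm h1 (by positivity))
        refine hz ?_
        rw [hzr, h2, toC_zero]
        simp [bform]
      obtain ⟨A, hA, s, hs, hAs⟩ := exists_rotation_apply_zero i
      obtain ⟨h1, h2⟩ := transpose_mul_self_of_mem hA
      have h1' : A.transpose.transpose * A.transpose = 1 := by rwa [Matrix.transpose_transpose]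
      set ε : ℝ := (1 + 3 * ‖z‖)⁻¹ with hε
      have hε0 : 0 < ε := by positivity
      have hball : 9 * ε ^ 2 * ‖matAct A.transpose z‖ ^ 2 < 1 := by
        rw [norm_matAct h1']
        have h3 : 3 * ‖z‖ * ε < 1 := by
          rw [hε, ← div_eq_mul_inv, div_lt_one (by positivity)]
          linarith
        calc 9 * ε ^ 2 * ‖z‖ ^ 2 = (3 * ‖z‖ * ε) ^ 2 := by ring
          _ < 1 := pow_lt_one₀ (by positivity) h3 two_ne_zero
      refine ⟨A, hA, ε, ?_⟩
      rw [image_matAct_eq h1 h2]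
      refine ⟨hball, ?_⟩
      have hDim : (confDenom ε (matAct A.transpose z)).im = 2 * ε * s * (z i).im := by
        have h4 : confDenom ε (matAct A.transpose z) =
            1 + ((2 * ε * s : ℝ) : ℂ) * z i + ((ε ^ 2 : ℝ) : ℂ) * bform z z := by
          rw [confDenom, hAs, bform_matAct_self h1']
          push_cast
          ring
        rw [h4, Complex.add_im, Complex.add_im, Complex.im_ofReal_mul, Complex.im_ofReal_mul,
          hslit.2, Complex.one_im]
        ring
      rw [bform_matAct_self h1', Complex.mem_slitPlane_iff]
      right
      intro h5
      set D := confDenom ε (matAct A.transpose z)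
      have h6 : bform z z = ((bform z z / D).re : ℂ) * D := by
        have h7 : ((bform z z / D).re : ℂ) = bform z z / D :=
          Complex.ext (by simp) (by simp [h5])
        rw [h7, div_mul_cancel₀ _ (confDenom_ne_zero hball)]
      have h8 : (bform z z).im = (bform z z / D).re * D.im := by
        conv_lhs => rw [h6]
        rw [Complex.im_ofReal_mul]
      rw [hslit.2, hDim] at h8
      rcases mul_eq_zero.1 h8.symm with h9 | h9
      · refine hz ?_
        rw [h6, h9, Complex.ofReal_zero, zero_mul]
      · exact mul_ne_zero (mul_ne_zero (mul_ne_zero two_ne_zero hε0.ne') hs) hi h9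
  · refine iUnion₂_subset fun A hA => iUnion_subset fun ε => ?_
    rintro _ ⟨z, hz, rfl⟩
    change bform _ _ ≠ 0
    rw [bform_matAct_self (transpose_mul_self_of_mem hA).1]
    exact bform_ne_zero_of_mem_curvedHull hz

/-! ### The conformal transformation -/

lemma curvedHull_zero : curvedHull n 0 = reducedHull ({0}ᶜ : Set (RSpace n)) := by
  ext z
  simp [curvedHull, reducedHull]

lemma bform_toC_e₁ (z : CSpace n) : bform z (toC (e₁ n)) = z 0 := by
  rw [bform, Finset.sum_eq_single 0]
  · simp [e₁]
  · intro j _ hj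
    simp [e₁, hj]
  · simp

lemma bform_confMap_self {ε : ℝ} {z : CSpace n} (hD : confDenom ε z ≠ 0) :
    bform (confMap ε z) (confMap ε z) = bform z z / confDenom ε z := by
  have h1 : bform (toC (e₁ n)) (toC (e₁ n)) = 1 := by
    rw [bform_toC_e₁]
    simp [e₁]
  rw [confMap, bform_smul_self, bform_add_left, bform_add_right, bform_add_right,
    bform_smul_left, bform_smul_right, bform_smul_right, bform_smul_left, h1, bform_toC_e₁,
    bform_comm (toC (e₁ n)), bform_toC_e₁]
  have h2 : bform z z + (ε : ℂ) * bform z z * z 0 +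
      ((ε : ℂ) * bform z z * z 0 + (ε : ℂ) * bform z z * ((ε : ℂ) * bform z z * 1)) =
      bform z z * confDenom ε z := by
    rw [confDenom]
    ring
  rw [h2]
  field_simp

lemma bform_confMap_sub_self {ε : ℝ} (hε : ε ≠ 0) {z : CSpace n} (hD : confDenom ε z ≠ 0) :
    bform (confMap ε z - toC (ε⁻¹ • e₁ n)) (confMap ε z - toC (ε⁻¹ • e₁ n)) =
      ((ε⁻¹ ^ 2 : ℝ) : ℂ) * (confDenom ε z)⁻¹ := by
  have hε' : (ε : ℂ) ≠ 0 := by exact_mod_cast hε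
  have h1 : bform (toC (e₁ n)) (toC (e₁ n)) = 1 := by
    rw [bform_toC_e₁]
    simp [e₁]
  have h2 : bform (confMap ε z) (toC (e₁ n)) =
      (confDenom ε z)⁻¹ * (z 0 + (ε : ℂ) * bform z z) := by
    rw [confMap, bform_smul_left, bform_add_left, bform_smul_left, h1, bform_toC_e₁, mul_one]
  rw [bform_sub_left, bform_sub_right, bform_sub_right, bform_confMap_self hD, toC_smul,
    bform_smul_left, bform_smul_right, bform_smul_right, bform_smul_left, h1,
    bform_comm (toC (e₁ n)), h2]
  push_cast
  field_simp
  rw [confDenom]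
  ring

theorem curvedHull_eq_preimage_reducedHull {ε : ℝ} (hε : ε ≠ 0) :
    curvedHull n ε = {z | 9 * ε ^ 2 * ‖z‖ ^ 2 < 1 ∧
      confMap ε z ∈ reducedHull ({0, ε⁻¹ • e₁ n}ᶜ : Set (RSpace n))} := by
  ext z
  refine and_congr_right fun hz => ?_
  have hD := confDenom_ne_zero hz
  have hre := re_confDenom_pos hz
  simp only [reducedHull, compl_compl, mem_insert_iff, mem_singleton_iff, forall_eq_or_imp,
    forall_eq, toC_zero, sub_zero, bform_confMap_self hD, mem_ofPred_eq]
  refine (and_iff_left ?_).symm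
  rw [bform_confMap_sub_self hε hD]
  refine ofReal_mul_mem_slitPlane (by positivity) (Or.inl ?_)
  rw [Complex.inv_re]
  exact div_pos hre (Complex.normSq_pos.2 hD)

/-! ### The union of the extension domains -/

theorem sUnion_isExtensionDomain (hn : 3 ≤ n) :
    ⋃₀ {W | IsExtensionDomain ({0}ᶜ : Set (RSpace n)) W ∧ toC '' ({0}ᶜ : Set (RSpace n)) ⊆ W} =
      {z | bform z z ≠ 0} := by
  refine subset_antisymm (sUnion_subset fun W hW =>
    hW.1.subset_of_harmonic_newtonian hn (harmonicOnNhd_newtonian (by omega))) fun z hz => ?_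
  rw [setOf_bform_ne_zero_eq_iUnion] at hz
  simp only [mem_iUnion] at hz
  obtain ⟨A, hA, ε, hzA⟩ := hz
  refine ⟨_, ⟨isExtensionDomain_wedge_union hn hA ε, ?_⟩, Or.inr hzA⟩
  rintro _ ⟨x, hx, rfl⟩
  exact Or.inl (toC_mem_wedge hx (by norm_num))

/-- A harmonic hull would be the union of all the extension domains that contain the punctured
space, but the Newtonian potential does not extend to the union. -/
theorem not_exists_isHarmonicHull (hodd : Odd n) (hn : 3 ≤ n) :
    ¬ ∃ H, IsHarmonicHull ({0}ᶜ : Set (RSpace n)) H := by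
  rintro ⟨H, hH, hHmax⟩
  refine not_extendsTo_newtonian hodd hn
    ((hH.1.extends_harmonic _ (harmonicOnNhd_newtonian (by omega))).mono ?_)
  rw [← sUnion_isExtensionDomain hn]
  exact sUnion_subset fun W hW => hHmax hW

end HarmonicHull

theorem mainTheorem4 (n : ℕ) [NeZero n] (hodd : Odd n) (hn : 3 ≤ n)
    (U : Set (HarmonicHull.RSpace n)) (hU : U = {0}ᶜ) :
    -- the set `Ũ` is the complement of the null cone
    HarmonicHull.tildeHull U = {z | HarmonicHull.bform z z ≠ 0} ∧
    -- `Ũ` is the only candidate for the harmonic hull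
    (∀ W, HarmonicHull.IsExtensionDomain U W → W ⊆ HarmonicHull.tildeHull U) ∧
    (⋃₀ {W | HarmonicHull.IsExtensionDomain U W ∧ HarmonicHull.toC '' U ⊆ W}
      = HarmonicHull.tildeHull U) ∧
    -- the Newtonian potential does not extend to `Ũ`
    (InnerProductSpace.HarmonicOnNhd (HarmonicHull.newtonian n) U ∧
      ¬ HarmonicHull.ExtendsTo U (HarmonicHull.newtonian n) (HarmonicHull.tildeHull U)) ∧
    -- there is no harmonic hull
    (¬ ∃ H, HarmonicHull.IsHarmonicHull U H) ∧
    -- the pieces are obtained from reduced harmonic hulls by conformal transformations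
    HarmonicHull.curvedHull n 0 = HarmonicHull.reducedHull U ∧
    (∀ ε : ℝ, ε ≠ 0 → HarmonicHull.curvedHull n ε =
      {z | 9 * ε ^ 2 * ‖z‖ ^ 2 < 1 ∧ HarmonicHull.confMap ε z ∈
        HarmonicHull.reducedHull ({0, ε⁻¹ • HarmonicHull.e₁ n}ᶜ : Set (HarmonicHull.RSpace n))}) ∧
    -- all harmonic functions on `U` extend to each of the rotated pieces
    (∀ A ∈ Matrix.specialOrthogonalGroup (Fin n) ℝ, ∀ ε : ℝ,
      HarmonicHull.IsExtensionDomain U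
        (HarmonicHull.matAct A '' HarmonicHull.curvedHull n ε)) ∧
    -- and `Ũ` is the union of the rotated pieces
    HarmonicHull.tildeHull U =
      ⋃ A ∈ Matrix.specialOrthogonalGroup (Fin n) ℝ, ⋃ ε : ℝ,
        HarmonicHull.matAct A '' HarmonicHull.curvedHull n ε := by
  subst hU
  have hN := HarmonicHull.harmonicOnNhd_newtonian (n := n) (by omega)
  rw [HarmonicHull.tildeHull_compl_zero (by omega)]
  exact ⟨rfl, fun W hW => hW.subset_of_harmonic_newtonian hn hN,
    HarmonicHull.sUnion_isExtensionDomain hn,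
    ⟨hN, HarmonicHull.not_extendsTo_newtonian hodd hn⟩,
    HarmonicHull.not_exists_isHarmonicHull hodd hn, HarmonicHull.curvedHull_zero,
    fun ε hε => HarmonicHull.curvedHull_eq_preimage_reducedHull hε,
    fun A hA ε => HarmonicHull.isExtensionDomain_image_curvedHull hn hA ε,
    HarmonicHull.setOf_bform_ne_zero_eq_iUnion⟩
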